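/- For $n\ge 0$ and $\alpha\in\mathbf N^n$ let $h_\alpha$ be the $L^2$-normalized Hermite function on $\mathbf R^n$, $$h_\alpha(x)=\pi^{-n/4}(-1)^{|\alpha|}(2^{|\alpha|}\alpha!)^{-1/2}e^{|x|^2/2}\,\partial^\alpha\big(e^{-|x|^2}\big),\qquad |\alpha|=\alpha_1+\cdots+\alpha_n .$$ For $s>0$ let $\mathcal H_s(\mathbf R^n)$ (respectively $\mathcal H_{0,s}(\mathbf R^n)$) be the set of all functions $f=\sum_{\alpha\in\mathbf N^n}c_\alpha h_\alpha$ on $\mathbf R^n$ whose coefficients $c_\alpha\in\mathbf C$ satisfy, for some $r>0$ (respectively for every $r>0$), $$\sup_{\alpha\in\mathbf N^n}|c_\alpha|\,e^{r|\alpha|^{1/(2s)}}<\infty .$$ For a real $d\times d$ matrix $A$ and a rapidly decreasing symbol $a$ on $\mathbf R^{2d}=\mathbf R^d\times\mathbf R^d$, let $\operatorname{Op}_A(a)$ be the operator on the Schwartz space $\mathscr S(\mathbf R^d)$ given by $$\operatorname{Op}_A(a)f(x)=(2\pi)^{-d}\iint_{\mathbf R^{2d}}a(x-A(x-y),\xi)\,f(y)\,e^{i\langle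 x-y,\xi\rangle}\,dy\,d\xi ,$$ and write $a=a_1\#_Aa_2$ if $\operatorname{Op}_A(a)=\operatorname{Op}_A(a_1)\circ\operatorname{Op}_A(a_2)$ on $\mathscr S(\mathbf R^d)$. **Theorem.** Let $A$ be a real $d\times d$ matrix, $s_1\ge\frac12$ and $s_2>\frac12$. Then the following is true: 1. if $a\in\mathcal H_{s_1}(\mathbf R^{2d})$, then there are $a_1,a_2\in\mathcal H_{s_1}(\mathbf R^{2d})$ such that $a=a_1\#_Aa_2$; 2. if $a\in\mathcal H_{0,s_2}(\mathbf R^{2d})$, then there are $a_1,a_2\in\mathcal H_{0,s_2}(\mathbf R^{2d})$ such that $a=a_1\#_Aa_2$. -/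

import Mathlib

noncomputable section

namespace Pilipovic

/-- The `L²`-normalized Hermite function of order `n` on the real line,
`h_n(x) = π^{-1/4} (n!)^{-1/2} He_n(√2 x) e^{-x²/2}`, where `He_n = Polynomial.hermite n` is the
probabilists' Hermite polynomial. Since `H_n(x) = 2^{n/2} He_n(√2 x)`, this is the usual
`π^{-1/4} (2^n n!)^{-1/2} H_n(x) e^{-x²/2} = (-1)^n π^{-1/4} (2^n n!)^{-1/2} e^{x²/2} ∂ⁿ e^{-x²}`. -/
def hermiteFun (n : ℕ) (x : ℝ) : ℝ :=
  Real.pi ^ (-(1 / 4) : ℝ) / Real.sqrt (n.factorial : ℝ) *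
    Polynomial.aeval (Real.sqrt 2 * x) (Polynomial.hermite n) * Real.exp (-(x ^ 2 / 2))

/-- The Hermite function `h_α` on `ℝ^ι`, with multi-index `α ∈ ℕ^ι`. -/
def hermiteFunction {ι : Type*} [Fintype ι] (α : ι → ℕ) (x : ι → ℝ) : ℝ :=
  ∏ i, hermiteFun (α i) (x i)

/-- `|c_α| ≤ C e^{-r |α|^{1/(2s)}}` for some constant `C`, where `|α| = ∑ i, α i`. -/
def HasDecay {ι : Type*} [Fintype ι] (s r : ℝ) (c : (ι → ℕ) → ℂ) : Prop :=
  ∃ C : ℝ, ∀ α : ι → ℕ, ‖c α‖ ≤ C * Real.exp (-(r * ((∑ i, α i : ℕ) : ℝ) ^ (1 / (2 * s))))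

/-- `f` is the (pointwise, absolutely convergent) sum of the Hermite series `∑ c_α h_α`. -/
def IsHermiteSeries {ι : Type*} [Fintype ι] (c : (ι → ℕ) → ℂ) (f : (ι → ℝ) → ℂ) : Prop :=
  ∀ x : ι → ℝ, HasSum (fun α : ι → ℕ => c α * (hermiteFunction α x : ℂ)) (f x)

/-- The Pilipović space `𝓗_s(ℝ^ι)` of Roumieu type, of order `s > 0`: Hermite series whose
coefficients are `O(e^{-r |α|^{1/(2s)}})` for some `r > 0`. -/
def roumieu (ι : Type*) [Fintype ι] (s : ℝ) : Set ((ι → ℝ) → ℂ) :=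
  {f | ∃ c : (ι → ℕ) → ℂ, (∃ r : ℝ, 0 < r ∧ HasDecay s r c) ∧ IsHermiteSeries c f}

/-- The Pilipović space `𝓗_{0,s}(ℝ^ι)` of Beurling type, of order `s > 0`: Hermite series whose
coefficients are `O(e^{-r |α|^{1/(2s)}})` for every `r > 0`. -/
def beurling (ι : Type*) [Fintype ι] (s : ℝ) : Set ((ι → ℝ) → ℂ) :=
  {f | ∃ c : (ι → ℕ) → ℂ, (∀ r : ℝ, 0 < r → HasDecay s r c) ∧ IsHermiteSeries c f}

/-- The pseudo-differential operator `Op_A(a)` with symbol `a(x, ξ)` on `ℝ^{2d} = ℝ^d × ℝ^d`,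
`Op_A(a) f(x) = (2π)^{-d} ∬ a(x - A(x - y), ξ) f(y) e^{i⟨x - y, ξ⟩} dξ dy`.
For `a` and `f` rapidly decreasing the integrals converge absolutely. -/
def Op {d : ℕ} (A : Matrix (Fin d) (Fin d) ℝ) (a : (Fin d ⊕ Fin d → ℝ) → ℂ)
    (f : (Fin d → ℝ) → ℂ) (x : Fin d → ℝ) : ℂ :=
  ((2 * Real.pi : ℝ) : ℂ)⁻¹ ^ d *
    ∫ y : Fin d → ℝ, ∫ ξ : Fin d → ℝ,
      a (Sum.elim (x - A.mulVec (x - y)) ξ) * f y *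
        Complex.exp (Complex.I * (((x - y) ⬝ᵥ ξ : ℝ) : ℂ))

/-- `a = a₁ #_A a₂`, that is, `Op_A(a) = Op_A(a₁) ∘ Op_A(a₂)` as operators on the Schwartz space
of `ℝ^d`. -/
def IsSharp {d : ℕ} (A : Matrix (Fin d) (Fin d) ℝ)
    (a a₁ a₂ : (Fin d ⊕ Fin d → ℝ) → ℂ) : Prop :=
  ∀ f : SchwartzMap (Fin d → ℝ) ℂ, Op A a f = Op A a₁ (Op A a₂ f)

end Pilipovic

end

/-!
An operator `Op_A(a)` is an integral operator whose kernel is, up to a constant, the partial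
Fourier transform of `a` in its second variable composed with the invertible linear map
`(x, y) ↦ (x - A (x - y), x - y)`. The partial Fourier transform multiplies Hermite coefficients by
powers of `i`. A linear change of variables `B` preserves the decay `e^{-r |α|^{1/(2s)}}`: the
ladder relations bound the Hermite coefficients of `h_α ∘ B` by `D 2^{|α|} e^{-κ |β|}`, so that
they are `O(e^{-κ |β| / 2})` unless `|β|` is at most a multiple of `|α|`, and this error is
admissible for some rate `r` as `2 s ≥ 1`, for every rate as soon as `2 s > 1`.

Hence symbols and kernels lie in the same space, and it is enough to factor the kernel, that is, the
matrix `k` of its Hermite coefficients. With `e_γ = sup_{|α| ≥ |γ|} |k_α|^{1/2}`, the matrix `k` is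
the product of the matrix `k_{(β, γ)} / e_γ`, whose entries are at most `|k_{(β, γ)}|^{1/2}`, and of
the diagonal matrix with entries `e_γ`; both factors decay as `k` does, at a smaller rate.
-/

namespace Pilipovic

open MeasureTheory Filter
open scoped Topology Matrix

/-! ### Hermite functions on the line -/

section HermitePolynomial

open Polynomial

lemma derivative_hermite_succ (n : ℕ) :
    derivative (hermite (n + 1)) = ((n : ℤ[X]) + 1) * hermite n := by
  induction n with
  | zero => simp
  | succ n ih =>
    rw [hermite_succ (n + 1), derivative_sub, derivative_mul, ih, derivative_mul]
    simp only [derivative_X, derivative_add, derivative_natCast, derivative_one]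
    push_cast
    linear_combination (-(n : ℤ[X]) - 1) * hermite_succ n

lemma derivative_hermite (n : ℕ) : derivative (hermite n) = (n : ℤ[X]) * hermite (n - 1) := by
  cases n with
  | zero => simp
  | succ n => simpa using derivative_hermite_succ n

lemma abs_pow_mul_exp_neg_sq_le (k : ℕ) (y : ℝ) :
    |y| ^ k * Real.exp (-(y ^ 2 / 8)) ≤ k.factorial * Real.exp 2 := by
  have pow_le : |y| ^ k ≤ k.factorial * Real.exp |y| := by
    have := Real.pow_div_factorial_le_exp _ (abs_nonneg y) k
    rwa [div_le_iff₀' (by positivity)] at this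
  have abs_le : |y| ≤ 2 + y ^ 2 / 8 := by nlinarith [sq_nonneg (|y| - 4), sq_abs y]
  calc |y| ^ k * Real.exp (-(y ^ 2 / 8))
      ≤ k.factorial * Real.exp (2 + y ^ 2 / 8) * Real.exp (-(y ^ 2 / 8)) := by
        gcongr
        exact pow_le.trans (by gcongr)
    _ = k.factorial * Real.exp 2 := by
        rw [mul_assoc, ← Real.exp_add, add_neg_cancel_right]

lemma exists_abs_aeval_mul_exp_neg_sq_le (p : ℤ[X]) :
    ∃ C : ℝ, ∀ y : ℝ, |aeval y p| * Real.exp (-(y ^ 2 / 8)) ≤ C := by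
  induction p using Polynomial.induction_on' with
  | add p q hp hq =>
    obtain ⟨C, hC⟩ := hp
    obtain ⟨D, hD⟩ := hq
    refine ⟨C + D, fun y => ?_⟩
    calc |aeval y (p + q)| * Real.exp (-(y ^ 2 / 8))
        ≤ (|aeval y p| + |aeval y q|) * Real.exp (-(y ^ 2 / 8)) := by
          rw [map_add]
          gcongr
          exact abs_add_le _ _
      _ ≤ C + D := by rw [add_mul]; exact add_le_add (hC y) (hD y)
  | monomial k a =>
    refine ⟨|(a : ℝ)| * (k.factorial * Real.exp 2), fun y => ?_⟩
    rw [aeval_monomial, abs_mul, mul_assoc, abs_pow, algebraMap_int_eq, eq_intCast]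
    exact mul_le_mul_of_nonneg_left (abs_pow_mul_exp_neg_sq_le k y) (abs_nonneg _)

end HermitePolynomial

section HermiteFun

open Polynomial (aeval hermite)

lemma sqrt_factorial_succ (n : ℕ) : √((n + 1).factorial : ℝ) = √(n + 1) * √(n.factorial : ℝ) := by
  rw [Nat.factorial_succ, Nat.cast_mul, Real.sqrt_mul (by positivity), Nat.cast_succ]

lemma hermiteFun_zero (x : ℝ) :
    hermiteFun 0 x = Real.pi ^ (-(1 / 4) : ℝ) * Real.exp (-(x ^ 2 / 2)) := by
  simp [hermiteFun]

lemma sqrt_mul_hermiteFun_pred (n : ℕ) (x : ℝ) :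
    √n * hermiteFun (n - 1) x =
      Real.pi ^ (-(1 / 4) : ℝ) / √(n.factorial : ℝ) * (n * aeval (√2 * x) (hermite (n - 1))) *
        Real.exp (-(x ^ 2 / 2)) := by
  cases n with
  | zero => simp
  | succ n =>
    have sq_sqrt : √((n : ℝ) + 1) ^ 2 = n + 1 := Real.sq_sqrt (by positivity)
    rw [hermiteFun, sqrt_factorial_succ]
    simp only [Nat.add_sub_cancel]
    push_cast
    field_simp
    linear_combination aeval (√2 * x) (hermite n) * sq_sqrt

lemma sqrt_mul_hermiteFun_succ (n : ℕ) (x : ℝ) :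
    √(n + 1) * hermiteFun (n + 1) x = √2 * x * hermiteFun n x - √n * hermiteFun (n - 1) x := by
  rw [sqrt_mul_hermiteFun_pred, hermiteFun, hermiteFun, sqrt_factorial_succ,
    Polynomial.hermite_succ, derivative_hermite]
  simp only [map_sub, map_mul, Polynomial.aeval_X, map_natCast]
  field_simp

lemma mul_hermiteFun (n : ℕ) (x : ℝ) :
    x * hermiteFun n x =
      (√n * hermiteFun (n - 1) x + √(n + 1) * hermiteFun (n + 1) x) / √2 := by
  rw [sqrt_mul_hermiteFun_succ, add_sub_cancel, eq_div_iff (by positivity)]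
  ring

/-- The derivative of `h_n`, in the form in which it combines with `mul_hermiteFun` to the
annihilation and creation operators. -/
noncomputable def hermiteFunDeriv (n : ℕ) (x : ℝ) : ℝ :=
  (√n * hermiteFun (n - 1) x - √(n + 1) * hermiteFun (n + 1) x) / √2

lemma hermiteFunDeriv_eq (n : ℕ) (x : ℝ) :
    hermiteFunDeriv n x = √2 * (√n * hermiteFun (n - 1) x) - x * hermiteFun n x := by
  have sq_sqrt_two : √2 ^ 2 = (2 : ℝ) := Real.sq_sqrt (by norm_num)
  rw [hermiteFunDeriv, sqrt_mul_hermiteFun_succ, div_eq_iff (by positivity)]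
  linear_combination -(√n * hermiteFun (n - 1) x) * sq_sqrt_two

lemma hasDerivAt_hermiteFun (n : ℕ) (x : ℝ) :
    HasDerivAt (hermiteFun n) (hermiteFunDeriv n x) x := by
  have polynomial : HasDerivAt (fun x : ℝ => aeval (√2 * x) (hermite n))
      (aeval (√2 * x) (Polynomial.derivative (hermite n)) * √2) x := by
    simpa [Function.comp_def] using (Polynomial.hasDerivAt_aeval (hermite n) (√2 * x)).comp x
      ((hasDerivAt_id x).const_mul √2)
  have gaussian : HasDerivAt (fun x : ℝ => Real.exp (-(x ^ 2 / 2)))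
      (Real.exp (-(x ^ 2 / 2)) * -x) x := by
    simpa using (((hasDerivAt_id x).pow 2).div_const 2).neg.exp
  refine ((polynomial.const_mul (Real.pi ^ (-(1 / 4) : ℝ) / √(n.factorial : ℝ))).mul
    gaussian).congr_deriv ?_
  rw [hermiteFunDeriv_eq, sqrt_mul_hermiteFun_pred, hermiteFun, derivative_hermite, map_mul,
    map_natCast]
  ring

@[fun_prop]
lemma continuous_hermiteFun (n : ℕ) : Continuous (hermiteFun n) :=
  continuous_iff_continuousAt.2 fun x => (hasDerivAt_hermiteFun n x).continuousAt

@[fun_prop]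
lemma continuous_hermiteFunDeriv (n : ℕ) : Continuous (hermiteFunDeriv n) := by
  unfold hermiteFunDeriv
  fun_prop

lemma exists_abs_hermiteFun_le_gaussian (n : ℕ) :
    ∃ C : ℝ, ∀ x : ℝ, |hermiteFun n x| ≤ C * Real.exp (-(1 / 4) * x ^ 2) := by
  obtain ⟨C, hC⟩ := exists_abs_aeval_mul_exp_neg_sq_le (hermite n)
  refine ⟨|Real.pi ^ (-(1 / 4) : ℝ) / √(n.factorial : ℝ)| * C, fun x => ?_⟩
  have exp_split : Real.exp (-(x ^ 2 / 2)) =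
      Real.exp (-((√2 * x) ^ 2 / 8)) * Real.exp (-(1 / 4) * x ^ 2) := by
    rw [← Real.exp_add, mul_pow, Real.sq_sqrt (by norm_num)]
    ring_nf
  rw [hermiteFun, exp_split, ← mul_assoc, mul_assoc (_ / _), abs_mul, abs_mul, abs_mul,
    Real.abs_exp, Real.abs_exp]
  gcongr
  exact hC _

lemma integrable_hermiteFun (n : ℕ) : Integrable (hermiteFun n) := by
  obtain ⟨C, hC⟩ := exists_abs_hermiteFun_le_gaussian n
  exact ((integrable_exp_neg_mul_sq (b := 1 / 4) (by norm_num)).const_mul C).mono'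
    (continuous_hermiteFun n).aestronglyMeasurable (.of_forall hC)

lemma tendsto_hermiteFun_atBot (n : ℕ) : Tendsto (hermiteFun n) atBot (𝓝 0) := by
  obtain ⟨C, hC⟩ := exists_abs_hermiteFun_le_gaussian n
  refine squeeze_zero_norm hC ?_
  rw [← mul_zero C]
  refine (Real.tendsto_exp_atBot.comp (Tendsto.const_mul_atTop_of_neg (by norm_num) ?_)).const_mul C
  simpa [Function.comp_def] using
    (tendsto_pow_atTop (α := ℝ) two_ne_zero).comp tendsto_abs_atBot_atTop

lemma integrable_hermiteFun_mul_hermiteFun (m n : ℕ) :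
    Integrable (fun x => hermiteFun m x * hermiteFun n x) := by
  obtain ⟨C, hC⟩ := exists_abs_hermiteFun_le_gaussian m
  refine (integrable_hermiteFun n).bdd_mul (c := |C|)
    (continuous_hermiteFun m).aestronglyMeasurable (.of_forall fun x => (hC x).trans ?_)
  calc C * Real.exp (-(1 / 4) * x ^ 2) ≤ |C| * 1 := by
        gcongr
        · exact le_abs_self C
        · exact Real.exp_le_one_iff.2 (by nlinarith [sq_nonneg x])
    _ = |C| := mul_one _

section IntegrationByParts

variable {E : Type*} [NormedAddCommGroup E] [NormedSpace ℝ E]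

lemma hermiteFunDeriv_smul (n : ℕ) (x : ℝ) (v : E) :
    hermiteFunDeriv n x • v =
      (√n / √2) • hermiteFun (n - 1) x • v - (√(n + 1) / √2) • hermiteFun (n + 1) x • v := by
  rw [hermiteFunDeriv, smul_smul, smul_smul, ← sub_smul]
  ring_nf

lemma integral_hermiteFun_smul_deriv {g g' : ℝ → E} (n : ℕ) (hg : ∀ x, HasDerivAt g (g' x) x)
    (integrable : ∀ m, Integrable (fun x => hermiteFun m x • g x))
    (integrable' : Integrable (fun x => hermiteFun n x • g' x)) :
    ∫ x, hermiteFun n x • g' x = (√(n + 1) / √2) • (∫ x, hermiteFun (n + 1) x • g x) -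
      (√n / √2) • ∫ x, hermiteFun (n - 1) x • g x := by
  have lower := (integrable (n - 1)).fun_smul (√n / √2)
  have raise := (integrable (n + 1)).fun_smul (√(n + 1) / √2)
  have by_parts := integral_bilinear_hasDerivAt_right_eq_neg_left_of_integrable
    (L := ContinuousLinearMap.lsmul ℝ ℝ) (fun x _ => hasDerivAt_hermiteFun n x) (fun x _ => hg x)
    integrable' (by simpa [hermiteFunDeriv_smul, Pi.sub_def] using lower.sub raise) (integrable n)
  simp only [ContinuousLinearMap.lsmul_apply, hermiteFunDeriv_smul] at by_parts
  rw [by_parts, integral_sub lower raise, integral_smul, integral_smul, neg_sub]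

end IntegrationByParts

lemma integrable_hermiteFun_mul_hermiteFunDeriv (m n : ℕ) :
    Integrable (fun x => hermiteFun m x * hermiteFunDeriv n x) := by
  simp_rw [mul_comm (hermiteFun m _), ← smul_eq_mul, hermiteFunDeriv_smul, smul_eq_mul]
  exact ((integrable_hermiteFun_mul_hermiteFun _ _).const_mul _).sub
    ((integrable_hermiteFun_mul_hermiteFun _ _).const_mul _)

lemma integral_hermiteFun_mul_add (m k l : ℕ) (a b : ℝ) :
    ∫ x, hermiteFun m x * (a * hermiteFun k x + b * hermiteFun l x) =
      a * (∫ x, hermiteFun m x * hermiteFun k x) + b * ∫ x, hermiteFun m x * hermiteFun l x := by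
  rw [← integral_const_mul, ← integral_const_mul,
    ← integral_add ((integrable_hermiteFun_mul_hermiteFun _ _).const_mul _)
      ((integrable_hermiteFun_mul_hermiteFun _ _).const_mul _)]
  congr! 2
  ring

-- Moving both `d/dx` and `x` from one factor to the other moves the annihilation operator.
lemma sqrt_mul_integral_hermiteFun_mul_hermiteFun (m n : ℕ) :
    √(m + 1) * ∫ x, hermiteFun (m + 1) x * hermiteFun n x =
      √n * ∫ x, hermiteFun m x * hermiteFun (n - 1) x := by
  have move_deriv := integral_hermiteFun_smul_deriv m (hasDerivAt_hermiteFun n)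
    (fun k => integrable_hermiteFun_mul_hermiteFun k n)
    (integrable_hermiteFun_mul_hermiteFunDeriv m n)
  have move_coord : ∫ x, hermiteFun m x * (x * hermiteFun n x) =
      ∫ x, hermiteFun n x * (x * hermiteFun m x) := by congr! 2; ring
  have deriv_eq (x : ℝ) : hermiteFunDeriv n x =
      √n / √2 * hermiteFun (n - 1) x + -(√(n + 1) / √2) * hermiteFun (n + 1) x := by
    rw [hermiteFunDeriv]
    ring
  simp only [smul_eq_mul, deriv_eq, mul_hermiteFun, add_div, mul_div_right_comm,
    integral_hermiteFun_mul_add] at move_deriv move_coord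
  simp only [mul_comm (hermiteFun n _)] at move_coord
  field_simp at move_deriv move_coord
  linarith

lemma integral_hermiteFun_zero_mul_self : ∫ x, hermiteFun 0 x * hermiteFun 0 x = 1 := by
  have sq_eq (x : ℝ) : hermiteFun 0 x * hermiteFun 0 x =
      Real.pi ^ (-(1 / 2) : ℝ) * Real.exp (-1 * x ^ 2) := by
    rw [hermiteFun_zero, mul_mul_mul_comm, ← Real.exp_add, ← Real.rpow_add Real.pi_pos]
    ring_nf
  simp_rw [sq_eq]
  rw [integral_const_mul, integral_gaussian, div_one, Real.sqrt_eq_rpow,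
    ← Real.rpow_add Real.pi_pos]
  norm_num

lemma integral_hermiteFun_mul_hermiteFun (m n : ℕ) :
    ∫ x, hermiteFun m x * hermiteFun n x = if m = n then 1 else 0 := by
  induction m generalizing n with
  | zero =>
    cases n with
    | zero => simpa using integral_hermiteFun_zero_mul_self
    | succ n =>
      have := sqrt_mul_integral_hermiteFun_mul_hermiteFun n 0
      simp only [mul_comm (hermiteFun 0 _)]
      simpa [(by positivity : √((n : ℝ) + 1) ≠ 0)] using this
  | succ m ih =>
    have sqrt_ne : √((m : ℝ) + 1) ≠ 0 := by positivity
    have step := sqrt_mul_integral_hermiteFun_mul_hermiteFun m n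
    rw [ih] at step
    cases n with
    | zero => simpa [sqrt_ne] using step
    | succ n =>
      rcases eq_or_ne m n with rfl | hmn
      · simpa [sqrt_ne] using step
      · simpa [sqrt_ne, hmn] using step

section PolynomialBounds

/-- Majorant of `(1 + x²) h_n²` and of `h_n² + (h_n')²`. -/
noncomputable def hermiteEnergy (n : ℕ) (x : ℝ) : ℝ :=
  hermiteFun n x ^ 2 + (n * hermiteFun (n - 1) x ^ 2 + (n + 1) * hermiteFun (n + 1) x ^ 2)

lemma integrable_hermiteFun_sq (n : ℕ) : Integrable (fun x => hermiteFun n x ^ 2) := by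
  simpa only [sq] using integrable_hermiteFun_mul_hermiteFun n n

lemma integral_hermiteFun_sq (n : ℕ) : ∫ x, hermiteFun n x ^ 2 = 1 := by
  simpa [sq] using integral_hermiteFun_mul_hermiteFun n n

lemma integrable_hermiteEnergy (n : ℕ) : Integrable (hermiteEnergy n) :=
  (integrable_hermiteFun_sq n).add
    (((integrable_hermiteFun_sq _).const_mul _).add ((integrable_hermiteFun_sq _).const_mul _))

lemma integral_hermiteEnergy (n : ℕ) : ∫ x, hermiteEnergy n x = 2 * n + 2 := by
  have lower := (integrable_hermiteFun_sq (n - 1)).const_mul (n : ℝ)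
  have raise := (integrable_hermiteFun_sq (n + 1)).const_mul ((n : ℝ) + 1)
  unfold hermiteEnergy
  rw [integral_add (integrable_hermiteFun_sq n) (lower.fun_add raise), integral_add lower raise,
    integral_const_mul, integral_const_mul]
  simp only [integral_hermiteFun_sq]
  ring

lemma sq_sqrt_mul_add_sqrt_mul_div_le {p q : ℝ} (hp : 0 ≤ p) (hq : 0 ≤ q) (a b : ℝ) :
    ((√p * a + √q * b) / √2) ^ 2 ≤ p * a ^ 2 + q * b ^ 2 := by
  have sq_add_le := add_sq_le (a := √p * a) (b := √q * b)
  rw [mul_pow, mul_pow, Real.sq_sqrt hp, Real.sq_sqrt hq] at sq_add_le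
  rw [div_pow, Real.sq_sqrt (by norm_num)]
  linarith

lemma one_add_sq_mul_hermiteFun_sq_le (n : ℕ) (x : ℝ) :
    (1 + x ^ 2) * hermiteFun n x ^ 2 ≤ hermiteEnergy n x := by
  have := sq_sqrt_mul_add_sqrt_mul_div_le n.cast_nonneg (by positivity : 0 ≤ (n : ℝ) + 1)
    (hermiteFun (n - 1) x) (hermiteFun (n + 1) x)
  rw [← mul_hermiteFun, mul_pow] at this
  unfold hermiteEnergy
  linarith

lemma hermiteFun_sq_add_hermiteFunDeriv_sq_le (n : ℕ) (x : ℝ) :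
    hermiteFun n x ^ 2 + hermiteFunDeriv n x ^ 2 ≤ hermiteEnergy n x := by
  have := sq_sqrt_mul_add_sqrt_mul_div_le n.cast_nonneg (by positivity : 0 ≤ (n : ℝ) + 1)
    (hermiteFun (n - 1) x) (-hermiteFun (n + 1) x)
  rw [mul_neg, ← sub_eq_add_neg, neg_sq] at this
  exact add_le_add_right this _

lemma le_integral_of_hasDerivAt_of_tendsto_atBot {F F' g : ℝ → ℝ}
    (hF : ∀ x, HasDerivAt F (F' x) x) (hF' : Continuous F') (hlim : Tendsto F atBot (𝓝 0))
    (hg : Integrable g) (hle : ∀ x, |F' x| ≤ g x) (x : ℝ) : F x ≤ ∫ y, g y := by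
  have integrable : Integrable F' := hg.mono' hF'.aestronglyMeasurable (.of_forall hle)
  calc F x = ∫ y in Set.Iic x, F' y := by
        rw [integral_Iic_of_hasDerivAt_of_tendsto' (fun y _ => hF y) integrable.integrableOn hlim,
          sub_zero]
    _ ≤ ∫ y in Set.Iic x, g y :=
        setIntegral_mono integrable.integrableOn hg.integrableOn
          fun y => (le_abs_self _).trans (hle y)
    _ ≤ ∫ y, g y :=
        setIntegral_le_integral hg (.of_forall fun y => (abs_nonneg _).trans (hle y))

lemma hermiteFun_sq_le (n : ℕ) (x : ℝ) : hermiteFun n x ^ 2 ≤ 2 * n + 2 := by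
  rw [← integral_hermiteEnergy]
  refine le_integral_of_hasDerivAt_of_tendsto_atBot (F := fun x => hermiteFun n x ^ 2)
    (F' := fun x => 2 * hermiteFun n x * hermiteFunDeriv n x) (fun x => ?_) (by fun_prop) ?_
    (integrable_hermiteEnergy n) (fun x => ?_) x
  · simpa using (hasDerivAt_hermiteFun n x).fun_pow 2
  · simpa using (tendsto_hermiteFun_atBot n).pow 2
  · refine le_trans ?_ (hermiteFun_sq_add_hermiteFunDeriv_sq_le n x)
    rw [abs_mul, abs_mul, abs_two, ← sq_abs (hermiteFun n x), ← sq_abs (hermiteFunDeriv n x)]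
    exact two_mul_le_add_sq _ _

lemma abs_hermiteFun_le (n : ℕ) (x : ℝ) : |hermiteFun n x| ≤ 3 * (n + 1) := by
  refine abs_le_of_sq_le_sq ((hermiteFun_sq_le n x).trans ?_) (by positivity)
  nlinarith [(Nat.cast_nonneg n : (0 : ℝ) ≤ n)]

lemma abs_le_half_inv_add_mul_sq {p : ℝ} (hp : 0 < p) (y : ℝ) :
    |y| ≤ 1 / 2 * (p⁻¹ + p * y ^ 2) := by
  have : 1 / 2 * (p⁻¹ + p * |y| ^ 2) - |y| = 1 / 2 * (1 - p * |y|) ^ 2 / p := by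
    field_simp
    ring
  rw [← sq_abs y, ← sub_nonneg, this]
  positivity

lemma integral_abs_hermiteFun_le (n : ℕ) : ∫ x, |hermiteFun n x| ≤ 3 * (n + 1) := by
  have integrable := integrable_inv_one_add_sq.add (integrable_hermiteEnergy n)
  calc ∫ x, |hermiteFun n x|
      ≤ ∫ x : ℝ, 1 / 2 * ((1 + x ^ 2)⁻¹ + hermiteEnergy n x) := by
        refine integral_mono (integrable_hermiteFun n).abs (integrable.const_mul _) fun x =>
          (abs_le_half_inv_add_mul_sq (by positivity : 0 < 1 + x ^ 2) _).trans ?_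
        gcongr
        exact one_add_sq_mul_hermiteFun_sq_le n x
    _ = 1 / 2 * (Real.pi + (2 * n + 2)) := by
        rw [integral_const_mul, integral_add integrable_inv_one_add_sq (integrable_hermiteEnergy n),
          integral_univ_inv_one_add_sq, integral_hermiteEnergy]
    _ ≤ 3 * (n + 1) := by linarith [Real.pi_lt_four, (Nat.cast_nonneg n : (0 : ℝ) ≤ n)]

end PolynomialBounds

section Fourier

open Complex (I)

/-- The Fourier integral of `h_n`, with the phase `e^{itx}` and without normalizing factor. -/
noncomputable def hermiteFourier (n : ℕ) (t : ℝ) : ℂ :=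
  ∫ x : ℝ, hermiteFun n x • Complex.exp (I * ((t * x : ℝ) : ℂ))

lemma integrable_hermiteFun_smul_cexp (n : ℕ) (t : ℝ) :
    Integrable (fun x : ℝ => hermiteFun n x • Complex.exp (I * ((t * x : ℝ) : ℂ))) := by
  refine (integrable_hermiteFun n).smul_bdd 1
    (Continuous.aestronglyMeasurable (by fun_prop)) (.of_forall fun x => ?_)
  rw [mul_comm, Complex.norm_exp_ofReal_mul_I]

lemma sqrt_mul_hermiteFourier_succ (n : ℕ) (t : ℝ) :
    √(n + 1) * hermiteFourier (n + 1) t =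
      √2 * t * I * hermiteFourier n t + √n * hermiteFourier (n - 1) t := by
  have hasDerivAt (x : ℝ) : HasDerivAt (fun x : ℝ => Complex.exp (I * ((t * x : ℝ) : ℂ)))
      ((I * t) * Complex.exp (I * ((t * x : ℝ) : ℂ))) x := by
    simpa [mul_comm] using ((((hasDerivAt_id x).const_mul t).ofReal_comp).const_mul I).cexp
  have by_parts := integral_hermiteFun_smul_deriv n hasDerivAt
    (fun m => integrable_hermiteFun_smul_cexp m t) (by
      simpa only [mul_smul_comm] using (integrable_hermiteFun_smul_cexp n t).const_mul (I * t))
  have sqrt_two_ne : (√2 : ℂ) ≠ 0 := by simp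
  simp only [← mul_smul_comm, integral_const_mul] at by_parts
  rw [← hermiteFourier, ← hermiteFourier, ← hermiteFourier] at by_parts
  simp only [Complex.real_smul, Complex.ofReal_div] at by_parts
  field_simp at by_parts
  linear_combination -by_parts

lemma hermiteFourier_zero (t : ℝ) : hermiteFourier 0 t = √(2 * Real.pi) * hermiteFun 0 t := by
  have integrand_eq (x : ℝ) : hermiteFun 0 x • Complex.exp (I * ((t * x : ℝ) : ℂ)) =
      (Real.pi ^ (-(1 / 4) : ℝ) : ℝ) *
        (Complex.exp (I * t * x) * Complex.exp (-(1 / 2 : ℂ) * (x : ℂ) ^ 2)) := by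
    rw [hermiteFun_zero, Complex.real_smul]
    push_cast
    ring_nf
  simp_rw [hermiteFourier, integrand_eq]
  rw [integral_const_mul, fourierIntegral_gaussian (by norm_num), hermiteFun_zero,
    Real.sqrt_eq_rpow, Complex.ofReal_mul, Complex.ofReal_cpow (by positivity) (1 / 2)]
  push_cast
  ring_nf

lemma hermiteFourier_eq (n : ℕ) (t : ℝ) :
    hermiteFourier n t = √(2 * Real.pi) * I ^ n * hermiteFun n t := by
  induction n using Nat.strong_induction_on with
  | h n ih =>
    cases n with
    | zero => simpa using hermiteFourier_zero t
    | succ n =>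
      have lower : (√n : ℂ) * hermiteFourier (n - 1) t =
          -√n * √(2 * Real.pi) * I ^ (n + 1) * hermiteFun (n - 1) t := by
        cases n with
        | zero => simp
        | succ n =>
          rw [ih _ (by omega), Nat.add_sub_cancel, pow_succ, pow_succ, mul_assoc _ I I,
            Complex.I_mul_I]
          ring
      have sqrt_ne : (√((n : ℝ) + 1) : ℂ) ≠ 0 := by
        exact_mod_cast (by positivity : √((n : ℝ) + 1) ≠ 0)
      have recurrence : (√(n + 1) * hermiteFun (n + 1) t : ℂ) =
          √2 * t * hermiteFun n t - √n * hermiteFun (n - 1) t := by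
        exact_mod_cast sqrt_mul_hermiteFun_succ n t
      refine mul_left_cancel₀ sqrt_ne ?_
      rw [sqrt_mul_hermiteFourier_succ, ih n n.lt_succ_self, lower]
      linear_combination (-(√(2 * Real.pi) : ℂ) * I ^ (n + 1)) * recurrence

end Fourier

end HermiteFun

/-! ### Hermite functions in several variables -/

section HermiteFunction

variable {ι : Type*} [Fintype ι]

/-- A common polynomial bound for the supremum and for the `L¹` norm of `h_α`. -/
noncomputable def weight (α : ι → ℕ) : ℝ := ∏ i, (3 * ((α i : ℝ) + 1))

lemma weight_pos (α : ι → ℕ) : 0 < weight α := Finset.prod_pos fun i _ => by positivity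

@[fun_prop]
lemma continuous_hermiteFunction (α : ι → ℕ) : Continuous (hermiteFunction α) := by
  unfold hermiteFunction
  fun_prop

lemma abs_hermiteFunction_le (α : ι → ℕ) (x : ι → ℝ) : |hermiteFunction α x| ≤ weight α := by
  rw [hermiteFunction, Finset.abs_prod]
  exact Finset.prod_le_prod (fun i _ => abs_nonneg _) fun i _ => abs_hermiteFun_le _ _

lemma norm_hermiteFunction_le (α : ι → ℕ) (x : ι → ℝ) :
    ‖(hermiteFunction α x : ℂ)‖ ≤ weight α := by
  simpa using abs_hermiteFunction_le α x

lemma hermiteFunction_zero_pos (x : ι → ℝ) : 0 < hermiteFunction (0 : ι → ℕ) x := by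
  refine Finset.prod_pos fun i _ => ?_
  rw [Pi.zero_apply, hermiteFun_zero]
  positivity

lemma integrable_hermiteFunction (α : ι → ℕ) : Integrable (hermiteFunction α) :=
  Integrable.fintype_prod (f := fun i => hermiteFun (α i)) fun i => integrable_hermiteFun (α i)

lemma integral_abs_hermiteFunction_le (α : ι → ℕ) :
    ∫ x, |hermiteFunction α x| ≤ weight α := by
  simp_rw [hermiteFunction, Finset.abs_prod]
  rw [integral_fintype_prod_volume_eq_prod (fun i x => |hermiteFun (α i) x|)]
  exact Finset.prod_le_prod (fun i _ => integral_nonneg fun x => abs_nonneg _)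
    fun i _ => integral_abs_hermiteFun_le _

lemma integral_hermiteFunction_mul_hermiteFunction (α β : ι → ℕ) :
    ∫ x, hermiteFunction α x * hermiteFunction β x = if α = β then 1 else 0 := by
  simp_rw [hermiteFunction, ← Finset.prod_mul_distrib]
  rw [integral_fintype_prod_volume_eq_prod (fun i x => hermiteFun (α i) x * hermiteFun (β i) x)]
  simp_rw [integral_hermiteFun_mul_hermiteFun]
  split_ifs with h
  · simp [h]
  · obtain ⟨i, hi⟩ := Function.ne_iff.1 h
    exact Finset.prod_eq_zero (Finset.mem_univ i) (if_neg hi)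

variable [DecidableEq ι]

lemma hermiteFunction_eq_prod_erase_mul {α β : ι → ℕ} {k : ι} (h : ∀ i, i ≠ k → β i = α i)
    (x : ι → ℝ) :
    hermiteFunction β x =
      (∏ i ∈ Finset.univ.erase k, hermiteFun (α i) (x i)) * hermiteFun (β k) (x k) := by
  rw [hermiteFunction, ← Finset.prod_erase_mul _ _ (Finset.mem_univ k)]
  congr 1
  exact Finset.prod_congr rfl fun i hi => by rw [h i (Finset.ne_of_mem_erase hi)]

lemma hermiteFunction_sub_single (α : ι → ℕ) (k : ι) (x : ι → ℝ) :
    hermiteFunction (α - Pi.single k 1) x =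
      (∏ i ∈ Finset.univ.erase k, hermiteFun (α i) (x i)) * hermiteFun (α k - 1) (x k) := by
  rw [hermiteFunction_eq_prod_erase_mul (α := α) (k := k) (fun i hi => by simp [hi])]
  simp

lemma hermiteFunction_add_single (α : ι → ℕ) (k : ι) (x : ι → ℝ) :
    hermiteFunction (α + Pi.single k 1) x =
      (∏ i ∈ Finset.univ.erase k, hermiteFun (α i) (x i)) * hermiteFun (α k + 1) (x k) := by
  rw [hermiteFunction_eq_prod_erase_mul (α := α) (k := k) (fun i hi => by simp [hi])]
  simp

lemma coord_mul_hermiteFunction (α : ι → ℕ) (k : ι) (x : ι → ℝ) :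
    x k * hermiteFunction α x =
      (√(α k) * hermiteFunction (α - Pi.single k 1) x +
        √(α k + 1) * hermiteFunction (α + Pi.single k 1) x) / √2 := by
  rw [hermiteFunction_sub_single, hermiteFunction_add_single,
    hermiteFunction_eq_prod_erase_mul (k := k) (fun _ _ => rfl), mul_left_comm, mul_hermiteFun]
  ring

/-- The partial derivative `∂_k h_α`. When `α k = 0` the truncated `α - Pi.single k 1` is
multiplied by `0`. -/
noncomputable def partialHermite (α : ι → ℕ) (k : ι) (x : ι → ℝ) : ℝ :=
  (√(α k) * hermiteFunction (α - Pi.single k 1) x -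
    √(α k + 1) * hermiteFunction (α + Pi.single k 1) x) / √2

lemma partialHermite_eq_prod_erase_mul (α : ι → ℕ) (k : ι) (x : ι → ℝ) :
    partialHermite α k x =
      (∏ i ∈ Finset.univ.erase k, hermiteFun (α i) (x i)) * hermiteFunDeriv (α k) (x k) := by
  rw [partialHermite, hermiteFunction_sub_single, hermiteFunction_add_single, hermiteFunDeriv]
  ring

lemma hasFDerivAt_hermiteFunction (α : ι → ℕ) (x : ι → ℝ) :
    HasFDerivAt (hermiteFunction α)
      (∑ k, partialHermite α k x • (ContinuousLinearMap.proj k : (ι → ℝ) →L[ℝ] ℝ)) x := by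
  have factor (i : ι) (_ : i ∈ Finset.univ) :
      HasFDerivAt (fun x : ι → ℝ => hermiteFun (α i) (x i)) (hermiteFunDeriv (α i) (x i) •
        (ContinuousLinearMap.proj i : (ι → ℝ) →L[ℝ] ℝ)) x :=
    HasDerivAt.comp_hasFDerivAt (h₂ := hermiteFun (α i)) x (hasDerivAt_hermiteFun (α i) (x i))
      (ContinuousLinearMap.proj i : (ι → ℝ) →L[ℝ] ℝ).hasFDerivAt
  refine (HasFDerivAt.finsetProd factor).congr_fderiv (Finset.sum_congr rfl fun k _ => ?_)
  rw [smul_smul, partialHermite_eq_prod_erase_mul]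

end HermiteFunction

/-! ### Hermite coefficients -/

section HermiteCoeff

variable {ι : Type*} [Fintype ι] {f g : (ι → ℝ) → ℂ}

/-- All the integrals that define the Hermite coefficients of `f` converge absolutely. -/
def HermiteIntegrable (f : (ι → ℝ) → ℂ) : Prop :=
  ∀ α : ι → ℕ, Integrable (fun x => f x * (hermiteFunction α x : ℂ))

/-- The coefficient `∫ f h_α` of `h_α` in the Hermite expansion of `f`. -/
noncomputable def hermiteCoeff (f : (ι → ℝ) → ℂ) (α : ι → ℕ) : ℂ :=
  ∫ x, f x * (hermiteFunction α x : ℂ)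

namespace HermiteIntegrable

lemma of_bounded {C : ℝ} (hf : AEStronglyMeasurable f) (hb : ∀ x, ‖f x‖ ≤ C) :
    HermiteIntegrable f :=
  fun α => (integrable_hermiteFunction α).ofReal.bdd_mul hf (.of_forall hb)

lemma of_integrable (hf : Integrable f) : HermiteIntegrable f :=
  fun α => hf.mul_bdd (Continuous.aestronglyMeasurable (by fun_prop))
    (.of_forall (norm_hermiteFunction_le α))

lemma const_mul (hf : HermiteIntegrable f) (c : ℂ) : HermiteIntegrable (fun x => c * f x) :=
  fun α => by simpa only [mul_assoc] using (hf α).const_mul c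

lemma add (hf : HermiteIntegrable f) (hg : HermiteIntegrable g) :
    HermiteIntegrable (fun x => f x + g x) :=
  fun α => by simpa only [add_mul] using (hf α).fun_add (hg α)

lemma sum {κ : Type*} {s : Finset κ} {F : κ → (ι → ℝ) → ℂ}
    (hF : ∀ k ∈ s, HermiteIntegrable (F k)) : HermiteIntegrable (fun x => ∑ k ∈ s, F k x) :=
  fun α => by
    simpa only [Finset.sum_mul] using integrable_finsetSum _ fun k hk => hF k hk α

end HermiteIntegrable

lemma hermiteCoeff_const_mul (c : ℂ) (f : (ι → ℝ) → ℂ) (α : ι → ℕ) :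
    hermiteCoeff (fun x => c * f x) α = c * hermiteCoeff f α := by
  simp only [hermiteCoeff, mul_assoc, integral_const_mul]

lemma hermiteCoeff_add (hf : HermiteIntegrable f) (hg : HermiteIntegrable g) (α : ι → ℕ) :
    hermiteCoeff (fun x => f x + g x) α = hermiteCoeff f α + hermiteCoeff g α := by
  simp only [hermiteCoeff, add_mul]
  exact integral_add (hf α) (hg α)

lemma hermiteCoeff_sub (hf : HermiteIntegrable f) (hg : HermiteIntegrable g) (α : ι → ℕ) :
    hermiteCoeff (fun x => f x - g x) α = hermiteCoeff f α - hermiteCoeff g α := by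
  simp only [hermiteCoeff, sub_mul]
  exact integral_sub (hf α) (hg α)

lemma hermiteCoeff_sum {κ : Type*} {s : Finset κ} {F : κ → (ι → ℝ) → ℂ}
    (hF : ∀ k ∈ s, HermiteIntegrable (F k)) (α : ι → ℕ) :
    hermiteCoeff (fun x => ∑ k ∈ s, F k x) α = ∑ k ∈ s, hermiteCoeff (F k) α := by
  simp only [hermiteCoeff, Finset.sum_mul]
  exact integral_finsetSum _ fun k hk => hF k hk α

lemma hermiteCoeff_hermiteFunction (α β : ι → ℕ) :
    hermiteCoeff (fun x => (hermiteFunction α x : ℂ)) β = if α = β then 1 else 0 := by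
  simp_rw [hermiteCoeff, ← Complex.ofReal_mul]
  rw [integral_complex_ofReal, integral_hermiteFunction_mul_hermiteFunction]
  split_ifs <;> simp

lemma hermiteCoeff_cexp (t : ι → ℝ) (α : ι → ℕ) :
    hermiteCoeff (fun x => Complex.exp (Complex.I * ((t ⬝ᵥ x : ℝ) : ℂ))) α =
      (√(2 * Real.pi) : ℂ) ^ Fintype.card ι * Complex.I ^ (∑ i, α i) * hermiteFunction α t := by
  have integrand_eq (x : ι → ℝ) :
      Complex.exp (Complex.I * ((t ⬝ᵥ x : ℝ) : ℂ)) * (hermiteFunction α x : ℂ) =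
        ∏ i, hermiteFun (α i) (x i) • Complex.exp (Complex.I * ((t i * x i : ℝ) : ℂ)) := by
    simp only [Complex.real_smul, Finset.prod_mul_distrib, ← Complex.exp_sum, dotProduct,
      hermiteFunction, Complex.ofReal_sum, Complex.ofReal_prod, Finset.mul_sum]
    ring
  simp_rw [hermiteCoeff, integrand_eq]
  rw [integral_fintype_prod_volume_eq_prod
    (fun i x => hermiteFun (α i) x • Complex.exp (Complex.I * ((t i * x : ℝ) : ℂ)))]
  change ∏ i, hermiteFourier (α i) (t i) = _
  simp [hermiteFourier_eq, Finset.prod_mul_distrib, Finset.prod_pow_eq_pow_sum, hermiteFunction]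

lemma coord_mul_mul_hermiteFunction [DecidableEq ι] (f : (ι → ℝ) → ℂ) (k : ι) (α : ι → ℕ)
    (x : ι → ℝ) :
    (x k : ℂ) * f x * hermiteFunction α x =
      (√(α k) * (f x * hermiteFunction (α - Pi.single k 1) x) +
        √(α k + 1) * (f x * hermiteFunction (α + Pi.single k 1) x)) / √2 := by
  have ladder : (x k * hermiteFunction α x : ℂ) =
      (√(α k) * hermiteFunction (α - Pi.single k 1) x +
        √(α k + 1) * hermiteFunction (α + Pi.single k 1) x) / √2 := by
    exact_mod_cast coord_mul_hermiteFunction α k x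
  linear_combination f x * ladder

lemma HermiteIntegrable.coord_mul (hf : HermiteIntegrable f) (k : ι) :
    HermiteIntegrable (fun x => (x k : ℂ) * f x) := fun α => by
  classical
  simp only [coord_mul_mul_hermiteFunction]
  exact (((hf _).const_mul _).add ((hf _).const_mul _)).div_const _

lemma hermiteCoeff_coord_mul [DecidableEq ι] (hf : HermiteIntegrable f) (k : ι)
    (α : ι → ℕ) :
    hermiteCoeff (fun x => (x k : ℂ) * f x) α =
      (√(α k) * hermiteCoeff f (α - Pi.single k 1) +
        √(α k + 1) * hermiteCoeff f (α + Pi.single k 1)) / √2 := by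
  simp only [hermiteCoeff, coord_mul_mul_hermiteFunction]
  rw [integral_div, integral_add ((hf _).const_mul _) ((hf _).const_mul _), integral_const_mul,
    integral_const_mul]

lemma mul_partialHermite [DecidableEq ι] (f : (ι → ℝ) → ℂ) (k : ι) (α : ι → ℕ) (x : ι → ℝ) :
    f x * partialHermite α k x =
      (√(α k) * (f x * hermiteFunction (α - Pi.single k 1) x) -
        √(α k + 1) * (f x * hermiteFunction (α + Pi.single k 1) x)) / √2 := by
  rw [partialHermite]
  push_cast
  ring

lemma integrable_mul_partialHermite [DecidableEq ι] (hf : HermiteIntegrable f) (k : ι)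
    (α : ι → ℕ) :
    Integrable (fun x => f x * (partialHermite α k x : ℂ)) := by
  simp only [mul_partialHermite]
  exact (((hf _).const_mul _).sub ((hf _).const_mul _)).div_const _

lemma hermiteCoeff_partialDeriv [DecidableEq ι] {f' : (ι → ℝ) → (ι → ℝ) →L[ℝ] ℂ}
    (hderiv : ∀ x, HasFDerivAt f (f' x) x) (hf : HermiteIntegrable f) {k : ι}
    (hf' : HermiteIntegrable (fun x => f' x (Pi.single k 1))) (α : ι → ℕ) :
    hermiteCoeff (fun x => f' x (Pi.single k 1)) α =
      (√(α k + 1) * hermiteCoeff f (α + Pi.single k 1) -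
        √(α k) * hermiteCoeff f (α - Pi.single k 1)) / √2 := by
  have hasFDerivAt_ofReal (x : ι → ℝ) :
      HasFDerivAt (fun x => (hermiteFunction α x : ℂ)) (Complex.ofRealCLM.comp
        (∑ k, partialHermite α k x • (ContinuousLinearMap.proj k : (ι → ℝ) →L[ℝ] ℝ))) x :=
    Complex.ofRealCLM.hasFDerivAt.comp x (hasFDerivAt_hermiteFunction α x)
  have partial_apply (x : ι → ℝ) : Complex.ofRealCLM.comp (∑ k, partialHermite α k x •
      (ContinuousLinearMap.proj k : (ι → ℝ) →L[ℝ] ℝ)) (Pi.single k 1) =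
        partialHermite α k x := by
    simp [Pi.single_apply]
  have by_parts := integral_bilinear_hasFDerivAt_right_eq_neg_left_of_integrable
    (μ := volume) (B := ContinuousLinearMap.mul ℝ ℂ) (v := Pi.single k 1) (hf' α)
    (by simpa only [partial_apply, ContinuousLinearMap.mul_apply'] using
      integrable_mul_partialHermite hf k α) (hf α)
    (fun x _ => hderiv x) (fun x _ => hasFDerivAt_ofReal x)
  simp only [partial_apply, ContinuousLinearMap.mul_apply'] at by_parts
  simp only [mul_partialHermite, integral_div] at by_parts
  rw [integral_sub ((hf _).const_mul _) ((hf _).const_mul _), integral_const_mul,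
    integral_const_mul, ← hermiteCoeff, ← hermiteCoeff, ← hermiteCoeff] at by_parts
  linear_combination by_parts

end HermiteCoeff

/-! ### Completeness of the Hermite functions -/

section Completeness

variable {ι : Type*} [Fintype ι] {f : (ι → ℝ) → ℂ}

lemma HermiteIntegrable.dotProduct_mul (hf : HermiteIntegrable f) (ξ : ι → ℝ) :
    HermiteIntegrable (fun x => ((ξ ⬝ᵥ x : ℝ) : ℂ) * f x) := by
  classical
  simp only [dotProduct, Complex.ofReal_sum, Complex.ofReal_mul, Finset.sum_mul, mul_assoc]
  exact .sum fun i _ => (hf.coord_mul i).const_mul _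

lemma hermiteCoeff_dotProduct_mul_eq_zero (hf : HermiteIntegrable f) (h : hermiteCoeff f = 0)
    (ξ : ι → ℝ) : hermiteCoeff (fun x => ((ξ ⬝ᵥ x : ℝ) : ℂ) * f x) = 0 := by
  classical
  ext α
  simp only [dotProduct, Complex.ofReal_sum, Complex.ofReal_mul, Finset.sum_mul, mul_assoc]
  rw [hermiteCoeff_sum fun i _ => (hf.coord_mul i).const_mul _]
  simp [hermiteCoeff_const_mul, hermiteCoeff_coord_mul hf, h]

lemma hermiteCoeff_dotProduct_pow_mul_eq_zero (hf : HermiteIntegrable f)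
    (h : hermiteCoeff f = 0) (ξ : ι → ℝ) (k : ℕ) :
    HermiteIntegrable (fun x => ((ξ ⬝ᵥ x : ℝ) : ℂ) ^ k * f x) ∧
      hermiteCoeff (fun x => ((ξ ⬝ᵥ x : ℝ) : ℂ) ^ k * f x) = 0 := by
  induction k with
  | zero => simpa using ⟨hf, h⟩
  | succ k ih =>
    simp only [pow_succ', mul_assoc]
    exact ⟨ih.1.dotProduct_mul ξ, hermiteCoeff_dotProduct_mul_eq_zero ih.1 ih.2 ξ⟩

lemma integrable_exp_abs_mul_hermiteFun_zero (a : ℝ) :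
    Integrable (fun x => Real.exp |a * x| * hermiteFun 0 x) := by
  refine ((integrable_exp_neg_mul_sq (b := 1 / 4) (by norm_num)).const_mul
    (Real.pi ^ (-(1 / 4) : ℝ) * Real.exp (a ^ 2))).mono'
    (Continuous.aestronglyMeasurable (by fun_prop)) (.of_forall fun x => ?_)
  rw [hermiteFun_zero, Real.norm_of_nonneg (by positivity), mul_left_comm, mul_assoc,
    ← Real.exp_add, ← Real.exp_add]
  refine mul_le_mul_of_nonneg_left (Real.exp_le_exp.2 ?_) (by positivity)
  rw [abs_mul]
  nlinarith [sq_nonneg (|a| - |x| / 2), sq_abs a, sq_abs x]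

lemma integrable_exp_abs_dotProduct_mul_hermiteFunction_zero (ξ : ι → ℝ) :
    Integrable (fun x => Real.exp |ξ ⬝ᵥ x| * hermiteFunction (0 : ι → ℕ) x) := by
  refine (Integrable.fintype_prod (f := fun i x => Real.exp |ξ i * x| * hermiteFun 0 x)
    fun i => integrable_exp_abs_mul_hermiteFun_zero (ξ i)).mono'
    (Continuous.aestronglyMeasurable (by fun_prop)) (.of_forall fun x => ?_)
  have pos := hermiteFunction_zero_pos x
  rw [Real.norm_of_nonneg (by positivity), Finset.prod_mul_distrib, ← Real.exp_sum]
  refine mul_le_mul_of_nonneg_right (Real.exp_le_exp.2 ?_) pos.le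
  exact Finset.abs_sum_le_sum_abs _ _

lemma integral_cexp_mul_eq_zero_of_integral_pow_mul_eq_zero {X : Type*} [MeasurableSpace X]
    {μ : Measure X} {y : X → ℝ} {g : X → ℂ} (hy : AEStronglyMeasurable y μ)
    (hg : AEStronglyMeasurable g μ) (hint : Integrable (fun x => Real.exp |y x| * ‖g x‖) μ)
    (h : ∀ k : ℕ, ∫ x, (y x : ℂ) ^ k * g x ∂μ = 0) :
    ∫ x, Complex.exp (Complex.I * y x) * g x ∂μ = 0 := by
  have expSeries (x : X) : HasSum (fun k : ℕ => Complex.I ^ k / (k.factorial : ℂ) *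
      ((y x : ℂ) ^ k * g x)) (Complex.exp (Complex.I * y x) * g x) := by
    rw [Complex.exp_eq_exp_ℂ]
    refine ((NormedSpace.expSeries_div_hasSum_exp (Complex.I * (y x : ℂ))).mul_right
      (g x)).congr_fun fun k => ?_
    rw [mul_pow]
    ring
  have realExpSeries (x : X) : HasSum (fun k : ℕ => |y x| ^ k / (k.factorial : ℝ) * ‖g x‖)
      (Real.exp |y x| * ‖g x‖) := by
    rw [Real.exp_eq_exp_ℝ]
    exact (NormedSpace.expSeries_div_hasSum_exp |y x|).mul_right _
  have termwise := hasSum_integral_of_dominated_convergence (μ := μ)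
    (F := fun (k : ℕ) x => Complex.I ^ k / (k.factorial : ℂ) * ((y x : ℂ) ^ k * g x))
    (fun (k : ℕ) x => |y x| ^ k / (k.factorial : ℝ) * ‖g x‖)
    (fun k => by fun_prop)
    (fun k => .of_forall fun x => le_of_eq (by simp [div_eq_inv_mul, mul_assoc]))
    (.of_forall fun x => (realExpSeries x).summable)
    (by simpa only [(realExpSeries _).tsum_eq] using hint)
    (.of_forall expSeries)
  simp only [integral_const_mul, h, mul_zero] at termwise
  exact termwise.unique hasSum_zero

lemma integral_cexp_dotProduct_mul_eq_zero {C : ℝ} (hf : Continuous f) (hb : ∀ x, ‖f x‖ ≤ C)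
    (h : hermiteCoeff f = 0) (ξ : ι → ℝ) :
    ∫ x, Complex.exp (Complex.I * (ξ ⬝ᵥ x : ℝ)) * (f x * hermiteFunction (0 : ι → ℕ) x) = 0 := by
  refine integral_cexp_mul_eq_zero_of_integral_pow_mul_eq_zero
    (Continuous.aestronglyMeasurable (by fun_prop))
    (Continuous.aestronglyMeasurable (by fun_prop)) ?_ fun k => ?_
  · refine ((integrable_exp_abs_dotProduct_mul_hermiteFunction_zero ξ).const_mul C).mono'
      (Continuous.aestronglyMeasurable (by fun_prop)) (.of_forall fun x => ?_)
    rw [norm_mul, norm_norm, norm_mul, Complex.norm_real, Real.norm_eq_abs, Real.abs_exp,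
      Real.norm_of_nonneg (hermiteFunction_zero_pos x).le, mul_left_comm]
    gcongr
    · exact mul_nonneg (Real.exp_nonneg _) (hermiteFunction_zero_pos x).le
    · exact hb x
  · have vanish := hermiteCoeff_dotProduct_pow_mul_eq_zero
      (.of_bounded hf.aestronglyMeasurable hb) h ξ k
    simpa only [hermiteCoeff, mul_assoc, Pi.zero_apply] using congrFun vanish.2 0

lemma eq_zero_of_integral_cexp_dotProduct_mul_eq_zero (hf : Continuous f) (hfi : Integrable f)
    (h : ∀ ξ : ι → ℝ, ∫ x, Complex.exp (Complex.I * (ξ ⬝ᵥ x : ℝ)) * f x = 0) : f = 0 := by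
  let F : EuclideanSpace ℝ ι → ℂ := fun v => f v.ofLp
  have continuous_F : Continuous F := hf.comp (PiLp.continuous_ofLp 2 _)
  have integrable_F : Integrable F := by
    rwa [← (PiLp.volume_preserving_toLp ι).integrable_comp_emb
      (MeasurableEquiv.toLp 2 _).measurableEmbedding]
  have fourier_F : FourierTransform.fourier F = 0 := by
    ext w
    rw [Real.fourier_eq', ← (PiLp.volume_preserving_toLp ι).integral_comp
      (MeasurableEquiv.toLp 2 _).measurableEmbedding, Pi.zero_apply,
      ← h ((-2 * Real.pi) • w.ofLp)]
    congr with x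
    have inner_eq : inner ℝ (WithLp.toLp 2 x) w = w.ofLp ⬝ᵥ x := by
      simp [PiLp.inner_apply, dotProduct]
    simp only [F, smul_eq_mul, inner_eq, smul_dotProduct]
    push_cast
    ring_nf
  have inversion := continuous_F.fourierInv_fourier_eq integrable_F
    (by rw [fourier_F]; exact integrable_zero _ _ _)
  have F_eq_zero : F = 0 := by
    ext v
    rw [← inversion, fourier_F, Real.fourierInv_eq']
    simp
  exact funext fun x => congrFun F_eq_zero (WithLp.toLp 2 x)

theorem eq_zero_of_hermiteCoeff_eq_zero {C : ℝ} (hf : Continuous f) (hb : ∀ x, ‖f x‖ ≤ C)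
    (h : hermiteCoeff f = 0) : f = 0 := by
  have mul_gaussian_eq_zero : (fun x => f x * (hermiteFunction (0 : ι → ℕ) x : ℂ)) = 0 :=
    eq_zero_of_integral_cexp_dotProduct_mul_eq_zero (by fun_prop)
      (HermiteIntegrable.of_bounded hf.aestronglyMeasurable hb 0)
      (integral_cexp_dotProduct_mul_eq_zero hf hb h)
  ext x
  have mul_eq_zero_at := congrFun mul_gaussian_eq_zero x
  simpa [(hermiteFunction_zero_pos x).ne'] using mul_eq_zero_at

end Completeness

/-! ### Hermite functions under a linear change of variables -/

section ChangeOfVariables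

variable {ι : Type*} [Fintype ι]

@[fun_prop]
lemma continuous_mulVec (B : Matrix ι ι ℝ) : Continuous (fun x : ι → ℝ => B *ᵥ x) :=
  continuous_const.matrix_mulVec continuous_id

variable [DecidableEq ι] {B : Matrix ι ι ℝ}

lemma measurableEmbedding_mulVec (hB : B.det ≠ 0) :
    MeasurableEmbedding (fun x : ι → ℝ => B *ᵥ x) :=
  (continuous_mulVec B).measurableEmbedding
    (Matrix.mulVec_injective_of_isUnit ((Matrix.isUnit_iff_isUnit_det B).2 hB.isUnit))

lemma map_mulVec_volume (hB : B.det ≠ 0) :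
    Measure.map (fun x : ι → ℝ => B *ᵥ x) volume =
      ENNReal.ofReal |B.det⁻¹| • (volume : Measure (ι → ℝ)) :=
  Real.map_matrix_volume_pi_eq_smul_volume_pi hB

variable {E : Type*} [NormedAddCommGroup E] {g : (ι → ℝ) → E}

lemma integrable_comp_mulVec (hB : B.det ≠ 0) (hg : Integrable g) :
    Integrable (fun x => g (B *ᵥ x)) := by
  refine (measurableEmbedding_mulVec hB).integrable_map_iff.1 ?_
  rw [map_mulVec_volume hB]
  exact hg.smul_measure ENNReal.ofReal_ne_top

lemma integral_comp_mulVec [NormedSpace ℝ E] (hB : B.det ≠ 0) (g : (ι → ℝ) → E) :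
    ∫ x, g (B *ᵥ x) = |B.det⁻¹| • ∫ x, g x := by
  rw [← (measurableEmbedding_mulVec hB).integral_map g, map_mulVec_volume hB,
    integral_smul_measure, ENNReal.toReal_ofReal (abs_nonneg _)]

end ChangeOfVariables

section Transfer

variable {ι : Type*} [Fintype ι]

/-- The coefficient of `h_β` in the Hermite expansion of `x ↦ h_α (B x)`. -/
noncomputable def transfer (B : Matrix ι ι ℝ) (α β : ι → ℕ) : ℂ :=
  hermiteCoeff (fun x => (hermiteFunction α (B *ᵥ x) : ℂ)) β

lemma hermiteIntegrable_hermiteFunction_comp_mulVec (B : Matrix ι ι ℝ) (α : ι → ℕ) :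
    HermiteIntegrable (fun x => (hermiteFunction α (B *ᵥ x) : ℂ)) :=
  .of_bounded (Continuous.aestronglyMeasurable (by fun_prop))
    fun _ => norm_hermiteFunction_le α _

lemma integrable_hermiteFunction_sq (α : ι → ℕ) :
    Integrable (fun x => hermiteFunction α x ^ 2) := by
  simp_rw [sq]
  exact (integrable_hermiteFunction α).bdd_mul (Continuous.aestronglyMeasurable (by fun_prop))
    (.of_forall (abs_hermiteFunction_le α))

lemma integral_hermiteFunction_sq (α : ι → ℕ) : ∫ x, hermiteFunction α x ^ 2 = 1 := by
  classical
  simpa [sq] using integral_hermiteFunction_mul_hermiteFunction α α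

variable [DecidableEq ι] {B : Matrix ι ι ℝ}

lemma norm_transfer_le (hB : B.det ≠ 0) (α β : ι → ℕ) :
    ‖transfer B α β‖ ≤ |B.det⁻¹| + 1 := by
  have integrable_comp_sq := integrable_comp_mulVec hB (integrable_hermiteFunction_sq α)
  have integrable_sq := integrable_hermiteFunction_sq β
  calc ‖transfer B α β‖
      ≤ ∫ x, (hermiteFunction α (B *ᵥ x) ^ 2 + hermiteFunction β x ^ 2) := by
        refine norm_integral_le_of_norm_le (integrable_comp_sq.add integrable_sq)
          (.of_forall fun x => ?_)
        rw [← Complex.ofReal_mul, Complex.norm_real, Real.norm_eq_abs, abs_le]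
        constructor <;> nlinarith [sq_nonneg (hermiteFunction α (B *ᵥ x) + hermiteFunction β x),
          sq_nonneg (hermiteFunction α (B *ᵥ x) - hermiteFunction β x)]
    _ = |B.det⁻¹| + 1 := by
        rw [integral_add integrable_comp_sq integrable_sq,
          integral_comp_mulVec hB (fun x => hermiteFunction α x ^ 2),
          integral_hermiteFunction_sq, integral_hermiteFunction_sq, smul_eq_mul, mul_one]

lemma coord_eq_sum_inv_mul_mulVec (hB : B.det ≠ 0) (x : ι → ℝ) (j : ι) :
    x j = ∑ k, B⁻¹ j k * (B *ᵥ x) k := by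
  have inv_mulVec : B⁻¹ *ᵥ (B *ᵥ x) = x := by
    rw [Matrix.mulVec_mulVec, Matrix.nonsing_inv_mul B hB.isUnit, Matrix.one_mulVec]
  exact (congrFun inv_mulVec j).symm

/-- The common shape `∑ₖ wₖ (√αₖ h_{α - eₖ} + σ √(αₖ + 1) h_{α + eₖ}) / √2`, evaluated at `B x`,
of the products of `h_α (B x)` with coordinates and of its partial derivatives. -/
noncomputable def ladderSum (B : Matrix ι ι ℝ) (α : ι → ℕ) (w : ι → ℝ) (σ : ℝ) (x : ι → ℝ) : ℂ :=
  ∑ k, (w k : ℂ) * ((√(α k) / √2 : ℝ) * hermiteFunction (α - Pi.single k 1) (B *ᵥ x) +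
    (σ * √(α k + 1) / √2 : ℝ) * hermiteFunction (α + Pi.single k 1) (B *ᵥ x))

lemma coord_mul_hermiteFunction_comp_mulVec (hB : B.det ≠ 0) (α : ι → ℕ) (j : ι) (x : ι → ℝ) :
    (x j : ℂ) * hermiteFunction α (B *ᵥ x) = ladderSum B α (fun k => B⁻¹ j k) 1 x := by
  rw [coord_eq_sum_inv_mul_mulVec hB x j, ladderSum, ← Complex.ofReal_mul, Finset.sum_mul]
  simp only [mul_assoc, coord_mul_hermiteFunction]
  push_cast
  exact Finset.sum_congr rfl fun k _ => by ring

lemma hasFDerivAt_hermiteFunction_comp_mulVec (B : Matrix ι ι ℝ) (α : ι → ℕ) (x : ι → ℝ) :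
    HasFDerivAt (fun x => (hermiteFunction α (B *ᵥ x) : ℂ))
      (Complex.ofRealCLM ∘L (∑ k, partialHermite α k (B *ᵥ x) •
        (ContinuousLinearMap.proj k : (ι → ℝ) →L[ℝ] ℝ)) ∘L B.mulVecLin.toContinuousLinearMap) x :=
  Complex.ofRealCLM.hasFDerivAt.comp x
    ((hasFDerivAt_hermiteFunction α (B *ᵥ x)).comp x
      B.mulVecLin.toContinuousLinearMap.hasFDerivAt)

lemma partialDeriv_hermiteFunction_comp_mulVec (B : Matrix ι ι ℝ) (α : ι → ℕ) (j : ι)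
    (x : ι → ℝ) :
    (Complex.ofRealCLM ∘L (∑ k, partialHermite α k (B *ᵥ x) •
      (ContinuousLinearMap.proj k : (ι → ℝ) →L[ℝ] ℝ)) ∘L B.mulVecLin.toContinuousLinearMap)
        (Pi.single j 1) = ladderSum B α (fun k => B k j) (-1) x := by
  simp only [ContinuousLinearMap.comp_apply, LinearMap.coe_toContinuousLinearMap',
    Matrix.mulVecLin_apply, Matrix.mulVec_single_one, sum_apply,
    smul_apply, ContinuousLinearMap.proj_apply, Complex.ofRealCLM_apply,
    smul_eq_mul, Matrix.col_apply, ladderSum, partialHermite]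
  push_cast
  exact Finset.sum_congr rfl fun k _ => by ring

lemma hermiteIntegrable_ladderSum (B : Matrix ι ι ℝ) (α : ι → ℕ) (w : ι → ℝ) (σ : ℝ) :
    HermiteIntegrable (ladderSum B α w σ) :=
  .sum fun _ _ => .const_mul (.add
    ((hermiteIntegrable_hermiteFunction_comp_mulVec B _).const_mul _)
    ((hermiteIntegrable_hermiteFunction_comp_mulVec B _).const_mul _)) _

lemma hermiteCoeff_ladderSum (B : Matrix ι ι ℝ) (α β : ι → ℕ) (w : ι → ℝ) (σ : ℝ) :
    hermiteCoeff (ladderSum B α w σ) β =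
      ∑ k, (w k : ℂ) * ((√(α k) / √2 : ℝ) * transfer B (α - Pi.single k 1) β +
        (σ * √(α k + 1) / √2 : ℝ) * transfer B (α + Pi.single k 1) β) := by
  have integrable (α : ι → ℕ) (p : ℂ) :=
    (hermiteIntegrable_hermiteFunction_comp_mulVec B α).const_mul p
  unfold ladderSum
  rw [hermiteCoeff_sum fun _ _ => .const_mul (.add (integrable _ _) (integrable _ _)) _]
  simp only [hermiteCoeff_const_mul, hermiteCoeff_add (integrable _ _) (integrable _ _), transfer]

variable {a : ℕ} {M : ℝ} {α β : ι → ℕ}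

lemma norm_hermiteCoeff_ladderSum_le
    (hM : ∀ α : ι → ℕ, ∑ i, α i ≤ a + 1 → ‖transfer B α β‖ ≤ M) (hα : ∑ i, α i ≤ a)
    (w : ι → ℝ) {σ : ℝ} (hσ : |σ| = 1) :
    ‖hermiteCoeff (ladderSum B α w σ) β‖ ≤ √2 * (∑ k, |w k|) * (√(a + 1) * M) := by
  have M_nonneg : 0 ≤ M := (norm_nonneg _).trans (hM α (by omega))
  have sqrt_two_mul : √2 * √2 = 2 := Real.mul_self_sqrt zero_le_two
  rw [hermiteCoeff_ladderSum, Finset.mul_sum, Finset.sum_mul]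
  refine (norm_sum_le _ _).trans (Finset.sum_le_sum fun k _ => ?_)
  have component_le : (α k : ℝ) ≤ a := by
    exact_mod_cast (Finset.single_le_sum (fun i _ => Nat.zero_le (α i))
      (Finset.mem_univ k)).trans hα
  have lower_le : ‖transfer B (α - Pi.single k 1) β‖ ≤ M := hM _ <|
    (Finset.sum_le_sum fun i _ => Nat.sub_le (α i) _).trans (by omega)
  have raise_le : ‖transfer B (α + Pi.single k 1) β‖ ≤ M := hM _ <| by
    simpa [Finset.sum_add_distrib] using hα
  calc ‖(w k : ℂ) * ((√(α k) / √2 : ℝ) * transfer B (α - Pi.single k 1) β +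
        (σ * √(α k + 1) / √2 : ℝ) * transfer B (α + Pi.single k 1) β)‖
      ≤ |w k| * (√(α k) / √2 * M + √(α k + 1) / √2 * M) := by
        rw [norm_mul, Complex.norm_real, Real.norm_eq_abs]
        gcongr
        refine (norm_add_le _ _).trans (add_le_add ?_ ?_)
        · rw [norm_mul, Complex.norm_real, Real.norm_of_nonneg (by positivity)]
          gcongr
        · rw [norm_mul, Complex.norm_real, norm_div, norm_mul, Real.norm_eq_abs σ, hσ, one_mul,
            Real.norm_of_nonneg (by positivity), Real.norm_of_nonneg (by positivity)]
          gcongr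
    _ ≤ |w k| * (√(a + 1) / √2 * M + √(a + 1) / √2 * M) := by
        gcongr
        linarith
    _ = √2 * |w k| * (√(a + 1) * M) := by
        field_simp
        linear_combination -(|w k| * M) * sqrt_two_mul

/-- A bound for the coefficients with which the ladder operators in the variable `x` are expressed
through those in the variable `B x`. -/
noncomputable def ladderConst (B : Matrix ι ι ℝ) : ℝ := ∑ j, ∑ k, (|B⁻¹ j k| + |B k j|)

lemma ladderConst_nonneg (B : Matrix ι ι ℝ) : 0 ≤ ladderConst B :=
  Finset.sum_nonneg fun _ _ => Finset.sum_nonneg fun _ _ => by positivity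

lemma sum_abs_add_sum_abs_le_ladderConst (B : Matrix ι ι ℝ) (j : ι) :
    ∑ k, |B⁻¹ j k| + ∑ k, |B k j| ≤ ladderConst B := by
  rw [← Finset.sum_add_distrib]
  exact Finset.single_le_sum (f := fun j => ∑ k, (|B⁻¹ j k| + |B k j|))
    (fun j _ => Finset.sum_nonneg fun _ _ => by positivity) (Finset.mem_univ j)

lemma hermiteCoeff_ladderSum_inv_row (hB : B.det ≠ 0) (α β : ι → ℕ) (j : ι) :
    hermiteCoeff (ladderSum B α (B⁻¹ j) 1) β =
      (√(β j) * transfer B α (β - Pi.single j 1) +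
        √(β j + 1) * transfer B α (β + Pi.single j 1)) / √2 := by
  have relation :=
    hermiteCoeff_coord_mul (hermiteIntegrable_hermiteFunction_comp_mulVec B α) j β
  simp only [coord_mul_hermiteFunction_comp_mulVec hB] at relation
  exact relation

lemma hermiteCoeff_ladderSum_col (B : Matrix ι ι ℝ) (α β : ι → ℕ) (j : ι) :
    hermiteCoeff (ladderSum B α (fun k => B k j) (-1)) β =
      (√(β j + 1) * transfer B α (β + Pi.single j 1) -
        √(β j) * transfer B α (β - Pi.single j 1)) / √2 := by
  have relation := hermiteCoeff_partialDeriv (k := j)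
    (hasFDerivAt_hermiteFunction_comp_mulVec B α)
    (hermiteIntegrable_hermiteFunction_comp_mulVec B α)
    (by simpa only [partialDeriv_hermiteFunction_comp_mulVec] using
      hermiteIntegrable_ladderSum B α _ _) β
  simp only [partialDeriv_hermiteFunction_comp_mulVec] at relation
  exact relation

lemma norm_add_norm_ladderSum_le
    (hM : ∀ α : ι → ℕ, ∑ i, α i ≤ a + 1 → ‖transfer B α β‖ ≤ M) (hα : ∑ i, α i ≤ a) (j : ι) :
    ‖hermiteCoeff (ladderSum B α (B⁻¹ j) 1) β‖ +
        ‖hermiteCoeff (ladderSum B α (fun k => B k j) (-1)) β‖ ≤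
      √2 * (ladderConst B * (√(a + 1) * M)) := by
  have M_nonneg : 0 ≤ M := (norm_nonneg _).trans (hM α (by omega))
  calc _ ≤ √2 * (∑ k, |B⁻¹ j k| + ∑ k, |B k j|) * (√(a + 1) * M) := by
        rw [mul_add, add_mul]
        exact add_le_add (norm_hermiteCoeff_ladderSum_le hM hα _ (by simp))
          (norm_hermiteCoeff_ladderSum_le hM hα _ (by simp))
    _ ≤ √2 * (ladderConst B * (√(a + 1) * M)) := by
        rw [mul_assoc]
        gcongr
        exact sum_abs_add_sum_abs_le_ladderConst B j

-- Adding and subtracting the relations for `x_j` and `∂_j` isolates the two terms on the left.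
lemma sqrt_mul_norm_transfer_le (hB : B.det ≠ 0)
    (hM : ∀ α : ι → ℕ, ∑ i, α i ≤ a + 1 → ‖transfer B α β‖ ≤ M) (hα : ∑ i, α i ≤ a) (j : ι) :
    √(β j) * ‖transfer B α (β - Pi.single j 1)‖ ≤ ladderConst B * (√(a + 1) * M) ∧
      √(β j + 1) * ‖transfer B α (β + Pi.single j 1)‖ ≤ ladderConst B * (√(a + 1) * M) := by
  have norm_sqrt_mul {t : ℝ} (z : ℂ) : √t * ‖z‖ = ‖(√t : ℂ) * z‖ := by
    rw [norm_mul, Complex.norm_real, Real.norm_of_nonneg (Real.sqrt_nonneg _)]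
  have norm_le {u X P : ℂ} (hu : √2 * u = X - P ∨ √2 * u = X + P)
      (hXP : ‖X‖ + ‖P‖ ≤ √2 * (ladderConst B * (√(a + 1) * M))) :
      ‖u‖ ≤ ladderConst B * (√(a + 1) * M) := by
    refine le_of_mul_le_mul_left ((norm_sqrt_mul u).trans_le (le_trans ?_ hXP)) (by positivity)
    rcases hu with hu | hu <;> rw [hu]
    exacts [norm_sub_le _ _, norm_add_le _ _]
  have sqrt_two_mul : (√2 : ℂ) * √2 = 2 := by
    exact_mod_cast Real.mul_self_sqrt zero_le_two
  have sum_le := norm_add_norm_ladderSum_le hM hα j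
  rw [norm_sqrt_mul, norm_sqrt_mul]
  refine ⟨norm_le (.inl ?_) sum_le, norm_le (.inr ?_) sum_le⟩ <;>
    rw [hermiteCoeff_ladderSum_inv_row hB, hermiteCoeff_ladderSum_col]
  · field_simp
    linear_combination √(β j) * transfer B α (β - Pi.single j 1) * sqrt_two_mul
  · field_simp
    linear_combination √(β j + 1) * transfer B α (β + Pi.single j 1) * sqrt_two_mul

lemma mul_norm_transfer_le (hB : B.det ≠ 0)
    (hM : ∀ α : ι → ℕ, ∑ i, α i ≤ a + 2 → ‖transfer B α β‖ ≤ M) (hα : ∑ i, α i ≤ a) (j : ι) :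
    β j * ‖transfer B α β‖ ≤ ladderConst B ^ 2 * (a + 2) * M := by
  have M_nonneg : 0 ≤ M := (norm_nonneg _).trans (hM α (by omega))
  have const_nonneg := ladderConst_nonneg B
  rcases Nat.eq_zero_or_pos (β j) with zero | pos
  · rw [zero, Nat.cast_zero, zero_mul]
    positivity
  have sqrt_pos : 0 < √(β j) := Real.sqrt_pos.2 (by positivity)
  have raise_lower : β - Pi.single j 1 + Pi.single j 1 = β := by
    ext i
    obtain rfl | hi := eq_or_ne i j
    · simp [Nat.sub_add_cancel pos]
    · simp [hi]
  obtain ⟨M', hM'⟩ : ∃ M', M' = ladderConst B * (√(a + 2) * M) / √(β j) := ⟨_, rfl⟩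
  have M'_nonneg : 0 ≤ M' := by rw [hM']; positivity
  have cast_add : ((a + 1 : ℕ) : ℝ) + 1 = a + 2 := by push_cast; ring
  have lower_le (α : ι → ℕ) (hα : ∑ i, α i ≤ a + 1) :
      ‖transfer B α (β - Pi.single j 1)‖ ≤ M' := by
    rw [hM', le_div_iff₀ sqrt_pos, mul_comm, ← cast_add]
    exact (sqrt_mul_norm_transfer_le hB (a := a + 1) hM hα j).1
  have step : √(β j) * ‖transfer B α β‖ ≤ ladderConst B * (√(a + 1) * M') := by
    have raise_le := (sqrt_mul_norm_transfer_le hB lower_le hα j).2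
    have raise_apply : ((β - Pi.single j (1 : ℕ) : ι → ℕ) j : ℝ) + 1 = β j := by
      simp [Nat.cast_sub (Nat.one_le_iff_ne_zero.2 pos.ne')]
    rwa [raise_lower, raise_apply] at raise_le
  calc β j * ‖transfer B α β‖ = √(β j) * (√(β j) * ‖transfer B α β‖) := by
        rw [← mul_assoc, Real.mul_self_sqrt (Nat.cast_nonneg _)]
    _ ≤ √(β j) * (ladderConst B * (√(a + 2) * M')) := by
        refine mul_le_mul_of_nonneg_left (step.trans ?_) sqrt_pos.le
        gcongr
        norm_num
    _ = ladderConst B ^ 2 * √(a + 2) ^ 2 * M := by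
        rw [hM']
        field_simp
    _ = ladderConst B ^ 2 * (a + 2) * M := by
        rw [Real.sq_sqrt (by positivity)]

lemma sum_mul_norm_transfer_le (hB : B.det ≠ 0)
    (hM : ∀ α : ι → ℕ, ∑ i, α i ≤ a + 2 → ‖transfer B α β‖ ≤ M) (hα : ∑ i, α i ≤ a) :
    (∑ i, β i : ℕ) * ‖transfer B α β‖ ≤ Fintype.card ι * ladderConst B ^ 2 * (a + 2) * M := by
  rw [Nat.cast_sum, Finset.sum_mul]
  refine (Finset.sum_le_sum fun j _ => mul_norm_transfer_le hB hM hα j).trans_eq ?_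
  rw [Finset.sum_const, Finset.card_univ, nsmul_eq_mul]
  ring

end Transfer

section IteratedDegreeBound

lemma prod_range_le_factorial (a N : ℕ) :
    ∏ i ∈ Finset.range N, ((a : ℝ) + 2 * i + 2) ≤ 2 ^ a * 4 ^ N * N.factorial := by
  have ascFactorial_le : (a + 1).ascFactorial N ≤ N.factorial * 2 ^ (a + N) := by
    rw [Nat.ascFactorial_eq_factorial_mul_choose]
    exact Nat.mul_le_mul_left _ (Nat.choose_le_two_pow _ _)
  calc ∏ i ∈ Finset.range N, ((a : ℝ) + 2 * i + 2)
      ≤ ∏ i ∈ Finset.range N, (2 * ((a + 1 + i : ℕ) : ℝ)) := by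
        refine Finset.prod_le_prod (fun i _ => by positivity) fun i _ => ?_
        push_cast
        linarith [(Nat.cast_nonneg a : (0 : ℝ) ≤ a)]
    _ = 2 ^ N * (a + 1).ascFactorial N := by
        rw [Finset.prod_mul_distrib, Finset.prod_const, Finset.card_range, ← Nat.cast_prod,
          ← Nat.ascFactorial_eq_prod_range]
    _ ≤ 2 ^ N * (N.factorial * 2 ^ (a + N) : ℕ) := by gcongr
    _ = 2 ^ a * 4 ^ N * N.factorial := by
        rw [show (4 : ℝ) = 2 * 2 by norm_num, mul_pow]
        push_cast
        ring

variable {X : Type*} {deg : X → ℕ} {t : X → ℝ} {b D K : ℝ}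

lemma pow_mul_le_of_degree_step (hb : 0 < b) (ht : ∀ x, t x ≤ D)
    (step : ∀ (a : ℕ) (M : ℝ), (∀ y, deg y ≤ a + 2 → t y ≤ M) →
      ∀ x, deg x ≤ a → b * t x ≤ K * (a + 2) * M)
    (N a : ℕ) (x : X) (hx : deg x ≤ a) :
    b ^ N * t x ≤ D * K ^ N * ∏ i ∈ Finset.range N, ((a : ℝ) + 2 * i + 2) := by
  induction N generalizing a x with
  | zero => simpa using ht x
  | succ N ih =>
    calc b ^ (N + 1) * t x = b ^ N * (b * t x) := by ring
      _ ≤ b ^ N * (K * (a + 2) *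
            ((D * K ^ N * ∏ i ∈ Finset.range N, (((a + 2 : ℕ) : ℝ) + 2 * i + 2)) / b ^ N)) := by
          refine mul_le_mul_of_nonneg_left (step a _ (fun y hy => ?_) x hx) (by positivity)
          rw [le_div_iff₀' (by positivity)]
          exact ih (a + 2) y hy
      _ = D * K ^ (N + 1) *
            ((∏ i ∈ Finset.range N, (((a + 2 : ℕ) : ℝ) + 2 * i + 2)) * (a + 2)) := by
          field_simp
          ring
      _ = D * K ^ (N + 1) * ∏ i ∈ Finset.range (N + 1), ((a : ℝ) + 2 * i + 2) := by
          rw [Finset.prod_range_succ']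
          push_cast
          simp only [mul_zero, add_zero, mul_add, mul_one, add_assoc, add_left_comm]

-- The bounds on `b ^ N * t x / N!` for all `N` add up to one on the exponential series.
lemma le_exp_of_degree_step (hb : 0 ≤ b) (hK : 0 < K) (hD : 0 ≤ D) (ht : ∀ x, t x ≤ D)
    (step : ∀ (a : ℕ) (M : ℝ), (∀ y, deg y ≤ a + 2 → t y ≤ M) →
      ∀ x, deg x ≤ a → b * t x ≤ K * (a + 2) * M) (x : X) :
    t x ≤ 2 * D * 2 ^ deg x * Real.exp (-(1 / (8 * K) * b)) := by
  rcases hb.eq_or_lt with rfl | hb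
  · have : (1 : ℝ) ≤ 2 ^ deg x := one_le_pow₀ one_le_two
    simp only [mul_zero, neg_zero, Real.exp_zero, mul_one]
    nlinarith [ht x]
  have term_le (N : ℕ) :
      (1 / (8 * K) * b) ^ N / N.factorial * t x ≤ D * 2 ^ deg x * (1 / 2) ^ N := by
    calc (1 / (8 * K) * b) ^ N / N.factorial * t x
        = b ^ N * t x / ((8 * K) ^ N * N.factorial) := by
          rw [mul_pow, one_div, inv_pow]
          field_simp
      _ ≤ D * K ^ N * (2 ^ deg x * 4 ^ N * N.factorial) / ((8 * K) ^ N * N.factorial) := by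
          refine div_le_div_of_nonneg_right
            ((pow_mul_le_of_degree_step hb ht step N (deg x) x le_rfl).trans ?_) (by positivity)
          gcongr
          exact prod_range_le_factorial _ N
      _ = D * 2 ^ deg x * (1 / 2) ^ N := by
          rw [mul_pow, show (8 : ℝ) = 4 * 2 by norm_num, mul_pow, one_div, inv_pow]
          field_simp
  have exp_series : HasSum (fun N : ℕ => (1 / (8 * K) * b) ^ N / (N.factorial : ℝ))
      (Real.exp (1 / (8 * K) * b)) := by
    rw [Real.exp_eq_exp_ℝ]
    exact NormedSpace.expSeries_div_hasSum_exp _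
  have exp_mul_le := hasSum_le term_le (exp_series.mul_right _)
    (hasSum_geometric_two.mul_left _)
  rw [Real.exp_neg, ← div_eq_mul_inv, le_div_iff₀ (Real.exp_pos _)]
  linarith

end IteratedDegreeBound

lemma exists_norm_transfer_le {ι : Type*} [Fintype ι] [DecidableEq ι] {B : Matrix ι ι ℝ}
    (hB : B.det ≠ 0) :
    ∃ D κ : ℝ, 0 < D ∧ 0 < κ ∧ ∀ α β : ι → ℕ, ‖transfer B α β‖ ≤ D ∧
      ‖transfer B α β‖ ≤ D * 2 ^ (∑ i, α i) * Real.exp (-(κ * (∑ i, β i : ℕ))) := by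
  set D := |B.det⁻¹| + 1
  set K := Fintype.card ι * ladderConst B ^ 2 + 1
  have D_pos : 0 < D := by positivity
  have K_pos : 0 < K := by positivity
  refine ⟨2 * D, 1 / (8 * K), by positivity, by positivity, fun α β =>
    ⟨(norm_transfer_le hB α β).trans (by linarith), ?_⟩⟩
  refine le_exp_of_degree_step (X := ι → ℕ) (deg := fun α => ∑ i, α i) (Nat.cast_nonneg _) K_pos
    D_pos.le (norm_transfer_le hB · β) (fun a M hM α hα => ?_) α
  have M_nonneg : 0 ≤ M := (norm_nonneg _).trans (hM α (hα.trans (Nat.le_add_right a 2)))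
  refine (sum_mul_norm_transfer_le hB hM hα).trans ?_
  gcongr
  exact (lt_add_one _).le

/-! ### Hermite series with weighted summable coefficients -/

section Summability

lemma exists_pow_le_exp_rpow {r θ : ℝ} (hr : 0 < r) (hθ : 0 < θ) (m : ℕ) :
    ∃ C : ℝ, ∀ n : ℕ, ((n : ℝ) + 1) ^ m ≤ C * Real.exp (r * (n : ℝ) ^ θ) := by
  have tendsto_zero : Tendsto (fun n : ℕ => (n : ℝ) ^ m * Real.exp (-(r * (n : ℝ) ^ θ))) atTop
      (𝓝 0) := by
    refine ((tendsto_rpow_mul_exp_neg_mul_atTop_nhds_zero (m / θ) r hr).comp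
      ((tendsto_rpow_atTop hθ).comp tendsto_natCast_atTop_atTop)).congr fun n => ?_
    simp only [Function.comp_apply]
    rw [← Real.rpow_mul (Nat.cast_nonneg n), mul_div_cancel₀ _ hθ.ne', Real.rpow_natCast, neg_mul]
  obtain ⟨C, hC⟩ := tendsto_zero.bddAbove_range
  have pow_le (n : ℕ) : (n : ℝ) ^ m ≤ C * Real.exp (r * (n : ℝ) ^ θ) := by
    have bound : (n : ℝ) ^ m * Real.exp (-(r * (n : ℝ) ^ θ)) ≤ C := hC ⟨n, rfl⟩
    rwa [Real.exp_neg, ← div_eq_mul_inv, div_le_iff₀ (Real.exp_pos _)] at bound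
  refine ⟨2 ^ (m - 1) * (C + 1), fun n => ?_⟩
  calc ((n : ℝ) + 1) ^ m ≤ 2 ^ (m - 1) * ((n : ℝ) ^ m + 1 ^ m) :=
        add_pow_le (Nat.cast_nonneg n) zero_le_one m
    _ ≤ 2 ^ (m - 1) * (C * Real.exp (r * (n : ℝ) ^ θ) + Real.exp (r * (n : ℝ) ^ θ)) := by
        gcongr
        · exact pow_le n
        · exact (one_pow m).trans_le (Real.one_le_exp (by positivity))
    _ = 2 ^ (m - 1) * (C + 1) * Real.exp (r * (n : ℝ) ^ θ) := by ring

variable {ι : Type*} [Fintype ι]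

lemma summable_prod_of_nonneg {X : ι → Type*} {f : ∀ i, X i → ℝ} (hf : ∀ i x, 0 ≤ f i x)
    (hs : ∀ i, Summable (f i)) : Summable (fun x : ∀ i, X i => ∏ i, f i (x i)) := by
  classical
  refine summable_of_sum_le (c := ∏ i, ∑' x, f i x)
    (fun x => Finset.prod_nonneg fun i _ => hf i _) fun u => ?_
  calc ∑ x ∈ u, ∏ i, f i (x i)
      ≤ ∑ x ∈ Fintype.piFinset (fun i => u.image (· i)), ∏ i, f i (x i) :=
        Finset.sum_le_sum_of_subset_of_nonneg
          (fun x hx => Fintype.mem_piFinset.2 fun i => Finset.mem_image_of_mem _ hx)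
          fun x _ _ => Finset.prod_nonneg fun i _ => hf i _
    _ = ∏ i, ∑ y ∈ u.image (· i), f i y := (Finset.prod_univ_sum _ _).symm
    _ ≤ ∏ i, ∑' y, f i y :=
        Finset.prod_le_prod (fun i _ => Finset.sum_nonneg fun y _ => hf i y)
          fun i _ => (hs i).sum_le_tsum _ fun y _ => hf i y

lemma summable_inv_weight_sq : Summable (fun α : ι → ℕ => (weight α ^ 2)⁻¹) := by
  have summable_factor : Summable (fun n : ℕ => ((3 * ((n : ℝ) + 1)) ^ 2)⁻¹) := by
    have := ((summable_nat_add_iff 1).2 (Real.summable_nat_pow_inv.2 one_lt_two)).mul_left (9⁻¹)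
    refine this.congr fun n => ?_
    rw [mul_pow, mul_inv]
    push_cast
    norm_num
  simpa only [weight, ← Finset.prod_pow, Finset.prod_inv_distrib] using
    summable_prod_of_nonneg (ι := ι) (fun _ _ => by positivity) fun _ => summable_factor

lemma weight_le_pow_card (α : ι → ℕ) :
    weight α ≤ (3 * ((∑ i, α i : ℕ) + 1 : ℝ)) ^ Fintype.card ι := by
  rw [← Finset.card_univ, ← Finset.prod_const]
  refine Finset.prod_le_prod (fun i _ => by positivity) fun i _ => ?_
  gcongr
  exact Finset.single_le_sum (fun i _ => Nat.zero_le (α i)) (Finset.mem_univ i)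

lemma summable_exp_mul_weight_pow {r θ : ℝ} (hr : 0 < r) (hθ : 0 < θ) (k : ℕ) :
    Summable (fun α : ι → ℕ => Real.exp (-(r * (∑ i, α i : ℕ) ^ θ)) * weight α ^ k) := by
  obtain ⟨C, hC⟩ := exists_pow_le_exp_rpow hr hθ (Fintype.card ι * (k + 2))
  refine Summable.of_nonneg_of_le (fun α => by have := weight_pos α; positivity) (fun α => ?_)
    ((summable_inv_weight_sq (ι := ι)).mul_left (3 ^ (Fintype.card ι * (k + 2)) * C))
  have weight_pos := weight_pos α
  rw [Real.exp_neg, ← div_eq_mul_inv, le_div_iff₀ (by positivity), mul_assoc, ← pow_add,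
    inv_mul_le_iff₀ (Real.exp_pos _)]
  calc weight α ^ (k + 2)
      ≤ ((3 * ((∑ i, α i : ℕ) + 1 : ℝ)) ^ Fintype.card ι) ^ (k + 2) := by
        gcongr
        exact weight_le_pow_card α
    _ = 3 ^ (Fintype.card ι * (k + 2)) *
          ((∑ i, α i : ℕ) + 1 : ℝ) ^ (Fintype.card ι * (k + 2)) := by
        rw [← pow_mul, mul_pow]
    _ ≤ 3 ^ (Fintype.card ι * (k + 2)) * (C * Real.exp (r * (∑ i, α i : ℕ) ^ θ)) := by
        gcongr
        exact hC _
    _ = Real.exp (r * (∑ i, α i : ℕ) ^ θ) * (3 ^ (Fintype.card ι * (k + 2)) * C) := by ring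

/-- Coefficient families whose Hermite series converges absolutely and uniformly on `ℝ^ι`: since
`|h_α| ≤ weight α`, the terms are dominated by a summable family of constants. -/
def WeightedSummable (c : (ι → ℕ) → ℂ) : Prop :=
  Summable fun α => ‖c α‖ * weight α

lemma HasDecay.exists_pos {s r : ℝ} {c : (ι → ℕ) → ℂ} (h : HasDecay s r c) :
    ∃ C : ℝ, 0 < C ∧ ∀ α : ι → ℕ,
      ‖c α‖ ≤ C * Real.exp (-(r * (∑ i, α i : ℕ) ^ (1 / (2 * s)))) := by
  obtain ⟨C, hC⟩ := h
  refine ⟨|C| + 1, by positivity, fun α => (hC α).trans ?_⟩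
  gcongr
  linarith [le_abs_self C]

lemma HasDecay.weightedSummable {s r : ℝ} (hs : 0 < s) (hr : 0 < r) {c : (ι → ℕ) → ℂ}
    (h : HasDecay s r c) : WeightedSummable c := by
  obtain ⟨C, -, hC⟩ := h.exists_pos
  have summable_exp := summable_exp_mul_weight_pow (ι := ι) hr (θ := 1 / (2 * s))
    (by positivity) 1
  refine Summable.of_nonneg_of_le (fun α => mul_nonneg (norm_nonneg _) (weight_pos α).le)
    (fun α => ?_) (summable_exp.mul_left C)
  rw [pow_one, ← mul_assoc]
  exact mul_le_mul_of_nonneg_right (hC α) (weight_pos α).le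

end Summability

section Series

lemma hasSum_mul_integral {I X : Type*} [Countable I] [MeasurableSpace X] {μ : Measure X}
    {c : I → ℂ} {F : I → X → ℂ} {f : X → ℂ} {W : I → ℝ} (hF : ∀ i, Integrable (F i) μ)
    (hW : ∀ i, ∫ x, ‖F i x‖ ∂μ ≤ W i) (hs : Summable fun i => ‖c i‖ * W i)
    (hf : ∀ x, HasSum (fun i => c i * F i x) (f x)) :
    HasSum (fun i => c i * ∫ x, F i x ∂μ) (∫ x, f x ∂μ) := by
  have summable_integral_norm : Summable fun i => ∫ x, ‖c i * F i x‖ ∂μ := by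
    refine hs.of_nonneg_of_le (fun i => integral_nonneg fun x => norm_nonneg _) fun i => ?_
    simp_rw [norm_mul]
    rw [integral_const_mul]
    exact mul_le_mul_of_nonneg_left (hW i) (norm_nonneg _)
  have hasSum_integral :=
    hasSum_integral_of_summable_integral_norm (fun i => (hF i).const_mul (c i))
      summable_integral_norm
  simpa only [integral_const_mul, fun x => (hf x).tsum_eq] using hasSum_integral

variable {ι : Type*} [Fintype ι] {c : (ι → ℕ) → ℂ} {f : (ι → ℝ) → ℂ}

lemma integral_norm_mul_hermiteFunction_le_of_bounded {C : ℝ} (hf : ∀ x, ‖f x‖ ≤ C) (α : ι → ℕ) :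
    ∫ x, ‖f x * (hermiteFunction α x : ℂ)‖ ≤ C * weight α :=
  calc ∫ x, ‖f x * (hermiteFunction α x : ℂ)‖
      ≤ ∫ x, C * |hermiteFunction α x| := by
        refine integral_mono_of_nonneg (.of_forall fun x => norm_nonneg _)
          ((integrable_hermiteFunction α).abs.const_mul C) (.of_forall fun x => ?_)
        simp only [norm_mul, Complex.norm_real, Real.norm_eq_abs]
        exact mul_le_mul_of_nonneg_right (hf x) (abs_nonneg _)
    _ ≤ C * weight α := by
        rw [integral_const_mul]
        exact mul_le_mul_of_nonneg_left (integral_abs_hermiteFunction_le α)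
          ((norm_nonneg _).trans (hf 0))

lemma integral_norm_mul_hermiteFunction_le_of_integrable (hf : Integrable f) (α : ι → ℕ) :
    ∫ x, ‖f x * (hermiteFunction α x : ℂ)‖ ≤ (∫ x, ‖f x‖) * weight α := by
  rw [← integral_mul_const]
  refine integral_mono_of_nonneg (.of_forall fun x => norm_nonneg _)
    (hf.norm.mul_const _) (.of_forall fun x => ?_)
  simp only [norm_mul]
  exact mul_le_mul_of_nonneg_left (norm_hermiteFunction_le α x) (norm_nonneg _)

lemma norm_mul_hermiteFunction_le (c : (ι → ℕ) → ℂ) (α : ι → ℕ) (x : ι → ℝ) :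
    ‖c α * (hermiteFunction α x : ℂ)‖ ≤ ‖c α‖ * weight α := by
  rw [norm_mul]
  exact mul_le_mul_of_nonneg_left (norm_hermiteFunction_le α x) (norm_nonneg _)

lemma WeightedSummable.isHermiteSeries_tsum (hc : WeightedSummable c) :
    IsHermiteSeries c (fun x => ∑' α, c α * (hermiteFunction α x : ℂ)) := fun x =>
  (Summable.of_norm_bounded hc fun α => norm_mul_hermiteFunction_le c α x).hasSum

namespace IsHermiteSeries

lemma continuous (h : IsHermiteSeries c f) (hc : WeightedSummable c) : Continuous f := by
  have eq_tsum : f = fun x => ∑' α, c α * (hermiteFunction α x : ℂ) :=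
    funext fun x => (h x).tsum_eq.symm
  rw [eq_tsum]
  exact continuous_tsum (fun α => by fun_prop) hc (norm_mul_hermiteFunction_le c)

lemma norm_le (h : IsHermiteSeries c f) (hc : WeightedSummable c) (x : ι → ℝ) :
    ‖f x‖ ≤ ∑' α, ‖c α‖ * weight α := by
  rw [← (h x).tsum_eq]
  exact tsum_of_norm_bounded hc.hasSum fun α => norm_mul_hermiteFunction_le c α x

lemma const_mul (h : IsHermiteSeries c f) (w : ℂ) :
    IsHermiteSeries (fun α => w * c α) (fun x => w * f x) := fun x => by
  simp_rw [mul_assoc]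
  exact (h x).mul_left w

lemma hasSum_hermiteCoeff_comp {κ : Type*} [Fintype κ] (h : IsHermiteSeries c f)
    (hc : WeightedSummable c) {φ : (κ → ℝ) → ι → ℝ} (hφ : Continuous φ) (β : κ → ℕ) :
    HasSum (fun α => c α * hermiteCoeff (fun x => (hermiteFunction α (φ x) : ℂ)) β)
      (hermiteCoeff (fun x => f (φ x)) β) := by
  have integrable (α : ι → ℕ) : Integrable fun x =>
      (hermiteFunction α (φ x) : ℂ) * (hermiteFunction β x : ℂ) :=
    HermiteIntegrable.of_bounded (Continuous.aestronglyMeasurable (by fun_prop))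
      (fun _ => norm_hermiteFunction_le α _) β
  refine hasSum_mul_integral (W := fun α => weight α * weight β) integrable
    (fun α => integral_norm_mul_hermiteFunction_le_of_bounded
      (fun x => norm_hermiteFunction_le α (φ x)) β)
    (by simpa only [mul_assoc] using Summable.mul_right (weight β) hc) fun x => ?_
  simp_rw [← mul_assoc]
  exact (h (φ x)).mul_right _

lemma hermiteCoeff_eq (h : IsHermiteSeries c f) (hc : WeightedSummable c) :
    hermiteCoeff f = c := by
  classical
  ext β
  refine (h.hasSum_hermiteCoeff_comp hc continuous_id β).unique ?_
  simp_rw [id, hermiteCoeff_hermiteFunction]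
  convert hasSum_single β fun α (hα : α ≠ β) => ?_ using 1 <;> simp_all

end IsHermiteSeries

theorem isHermiteSeries_hermiteCoeff {C : ℝ} (hf : Continuous f) (hb : ∀ x, ‖f x‖ ≤ C)
    (hs : WeightedSummable (hermiteCoeff f)) : IsHermiteSeries (hermiteCoeff f) f := by
  set g := fun x => ∑' α, hermiteCoeff f α * (hermiteFunction α x : ℂ)
  have hg : IsHermiteSeries (hermiteCoeff f) g := hs.isHermiteSeries_tsum
  have coeff_sub : hermiteCoeff (fun x => f x - g x) = 0 := by
    ext α
    rw [hermiteCoeff_sub (.of_bounded hf.aestronglyMeasurable hb)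
      (.of_bounded (hg.continuous hs).aestronglyMeasurable (hg.norm_le hs)),
      hg.hermiteCoeff_eq hs, sub_self, Pi.zero_apply]
  have sub_eq_zero_fun := eq_zero_of_hermiteCoeff_eq_zero (hf.sub (hg.continuous hs))
    (fun x => (norm_sub_le _ _).trans (add_le_add (hb x) (hg.norm_le hs x))) coeff_sub
  have f_eq_g : f = g := funext fun x => sub_eq_zero.1 (congrFun sub_eq_zero_fun x)
  rwa [← f_eq_g] at hg

end Series

/-! ### Linear changes of variables -/

section ChangeOfVariables

lemma exp_neg_mul_eq_mul_self_half (r x : ℝ) :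
    Real.exp (-(r * x)) = Real.exp (-(r / 2 * x)) * Real.exp (-(r / 2 * x)) := by
  rw [← Real.exp_add]
  ring_nf

-- Either `a ≤ κ b / 2`, and the factor `2 ^ a` eats up only half of the decay in `b`, or `b` is
-- bounded by a multiple of `a`, and the decay in `a` is one in `b`.
lemma exp_neg_rpow_mul_le {D κ ρ θ b t : ℝ} {a : ℕ} (hD : 0 < D) (hκ : 0 < κ) (hρ : 0 < ρ)
    (hθ : 0 < θ) (hb : 0 ≤ b) (ht : 0 ≤ t) (t_le : t ≤ D)
    (t_le_exp : t ≤ D * 2 ^ a * Real.exp (-(κ * b))) :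
    Real.exp (-(ρ * (a : ℝ) ^ θ)) * t ≤
      D * (Real.exp (-(κ / 2 * b)) + Real.exp (-(ρ * (κ / 2) ^ θ * b ^ θ))) := by
  rw [mul_add]
  rcases le_total (a : ℝ) (κ / 2 * b) with hab | hab
  · have two_pow_le : (2 : ℝ) ^ a ≤ Real.exp a := by
      rw [← Real.exp_one_pow]
      gcongr
      linarith [Real.add_one_le_exp 1]
    refine le_add_of_le_of_nonneg ?_ (by positivity)
    calc Real.exp (-(ρ * (a : ℝ) ^ θ)) * t
        ≤ t := mul_le_of_le_one_left ht (Real.exp_le_one_iff.2 (neg_nonpos.2 (by positivity)))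
      _ ≤ D * Real.exp a * Real.exp (-(κ * b)) := t_le_exp.trans (by gcongr)
      _ = D * Real.exp (a - κ * b) := by rw [mul_assoc, ← Real.exp_add, sub_eq_add_neg]
      _ ≤ D * Real.exp (-(κ / 2 * b)) := by
          gcongr
          linarith
  · have rpow_le : (κ / 2) ^ θ * b ^ θ ≤ (a : ℝ) ^ θ := by
      rw [← Real.mul_rpow (by positivity) hb]
      exact Real.rpow_le_rpow (by positivity) hab hθ.le
    refine le_add_of_nonneg_of_le (by positivity) ?_
    rw [mul_comm D, mul_assoc ρ]
    gcongr

variable {ι : Type*} [Fintype ι] {c : (ι → ℕ) → ℂ} {f : (ι → ℝ) → ℂ} {s : ℝ}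

lemma exists_norm_hermiteCoeff_comp_mulVec_le {B : Matrix ι ι ℝ} {D κ r : ℝ} (hD : 0 < D)
    (hκ : 0 < κ) (hB : ∀ α β : ι → ℕ, ‖transfer B α β‖ ≤ D ∧
      ‖transfer B α β‖ ≤ D * 2 ^ (∑ i, α i) * Real.exp (-(κ * (∑ i, β i : ℕ))))
    (hs : 0 < s) (hr : 0 < r) (hc : HasDecay s r c) (hf : IsHermiteSeries c f) :
    ∃ C : ℝ, 0 ≤ C ∧ ∀ β : ι → ℕ, ‖hermiteCoeff (fun x => f (B *ᵥ x)) β‖ ≤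
      C * (Real.exp (-(κ / 2 * (∑ i, β i : ℕ))) +
        Real.exp (-(r / 2 * (κ / 2) ^ (1 / (2 * s)) * (∑ i, β i : ℕ) ^ (1 / (2 * s))))) := by
  obtain ⟨C, C_pos, norm_c_le⟩ := hc.exists_pos
  set θ := 1 / (2 * s)
  have θ_pos : 0 < θ := by positivity
  set S := ∑' α : ι → ℕ, Real.exp (-(r / 2 * (∑ i, α i : ℕ) ^ θ))
  refine ⟨C * D * S, mul_nonneg (by positivity) (tsum_nonneg fun α => (Real.exp_pos _).le),
    fun β => ?_⟩
  set E := Real.exp (-(κ / 2 * (∑ i, β i : ℕ))) +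
    Real.exp (-(r / 2 * (κ / 2) ^ θ * (∑ i, β i : ℕ) ^ θ))
  have norm_term_le (α : ι → ℕ) : ‖c α * transfer B α β‖ ≤
      C * D * E * Real.exp (-(r / 2 * (∑ i, α i : ℕ) ^ θ)) := by
    calc ‖c α * transfer B α β‖
        ≤ C * Real.exp (-(r * (∑ i, α i : ℕ) ^ θ)) * ‖transfer B α β‖ := by
          rw [norm_mul]
          exact mul_le_mul_of_nonneg_right (norm_c_le α) (norm_nonneg _)
      _ = C * Real.exp (-(r / 2 * (∑ i, α i : ℕ) ^ θ)) *
            (Real.exp (-(r / 2 * (∑ i, α i : ℕ) ^ θ)) * ‖transfer B α β‖) := by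
          rw [exp_neg_mul_eq_mul_self_half]
          ring
      _ ≤ C * Real.exp (-(r / 2 * (∑ i, α i : ℕ) ^ θ)) * (D * E) :=
          mul_le_mul_of_nonneg_left (exp_neg_rpow_mul_le hD hκ (half_pos hr) θ_pos
            (Nat.cast_nonneg _) (norm_nonneg _) (hB α β).1 (hB α β).2) (by positivity)
      _ = C * D * E * Real.exp (-(r / 2 * (∑ i, α i : ℕ) ^ θ)) := by ring
  have summable_exp : Summable fun α : ι → ℕ => Real.exp (-(r / 2 * (∑ i, α i : ℕ) ^ θ)) := by
    simpa using summable_exp_mul_weight_pow (ι := ι) (half_pos hr) θ_pos 0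
  have hasSum_coeff := hf.hasSum_hermiteCoeff_comp (hc.weightedSummable hs hr)
    (continuous_mulVec B) β
  calc ‖hermiteCoeff (fun x => f (B *ᵥ x)) β‖
      ≤ C * D * E * S :=
        hasSum_coeff.norm_le_of_bounded (summable_exp.hasSum.mul_left _) norm_term_le
    _ = C * D * S * E := by ring

lemma hasDecay_of_norm_le_exp_add_exp {C p q r M : ℝ} (hC : 0 ≤ C)
    (hc : ∀ β : ι → ℕ, ‖c β‖ ≤ C * (Real.exp (-(p * (∑ i, β i : ℕ))) +
      Real.exp (-(q * (∑ i, β i : ℕ) ^ (1 / (2 * s))))))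
    (hp : ∀ n : ℕ, r * (n : ℝ) ^ (1 / (2 * s)) ≤ p * n + M) (hq : r ≤ q) : HasDecay s r c := by
  refine ⟨C * (Real.exp M + 1), fun β => (hc β).trans ?_⟩
  rw [mul_assoc, add_mul, one_mul, ← Real.exp_add]
  gcongr
  linarith [hp (∑ i, β i)]

lemma natCast_rpow_le_self {θ : ℝ} (hθ₀ : 0 < θ) (hθ₁ : θ ≤ 1) (n : ℕ) : (n : ℝ) ^ θ ≤ n := by
  rcases n.eq_zero_or_pos with rfl | hn
  · simp [Real.zero_rpow hθ₀.ne']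
  · simpa using Real.rpow_le_rpow_of_exponent_le (Nat.one_le_cast.2 hn) hθ₁

lemma exists_mul_rpow_le_mul_add {p r θ : ℝ} (hp : 0 < p) (hr : 0 < r) (hθ₀ : 0 < θ)
    (hθ₁ : θ < 1) : ∃ M : ℝ, ∀ x : ℝ, 0 ≤ x → r * x ^ θ ≤ p * x + M := by
  set b := (r / p) ^ (1 - θ)⁻¹
  have b_pos : 0 < b := by positivity
  have b_rpow : b ^ (1 - θ) = r / p := Real.rpow_inv_rpow (by positivity) (by linarith)
  refine ⟨p * b, fun x hx => ?_⟩
  have weighted_amgm := Real.geom_mean_le_arith_mean2_weighted hθ₀.le (sub_nonneg.2 hθ₁.le) hx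
    b_pos.le (add_sub_cancel θ 1)
  calc r * x ^ θ = p * (x ^ θ * b ^ (1 - θ)) := by
        rw [b_rpow]
        field_simp
    _ ≤ p * (θ * x + (1 - θ) * b) := by gcongr
    _ ≤ p * (1 * x + 1 * b) := by
        gcongr
        linarith
    _ = p * x + p * b := by ring

lemma IsHermiteSeries.comp_mulVec (hf : IsHermiteSeries c f) (hc : WeightedSummable c)
    {B : Matrix ι ι ℝ} (hB : WeightedSummable (hermiteCoeff fun x => f (B *ᵥ x))) :
    IsHermiteSeries (hermiteCoeff fun x => f (B *ᵥ x)) (fun x => f (B *ᵥ x)) :=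
  isHermiteSeries_hermiteCoeff ((hf.continuous hc).comp (continuous_mulVec B))
    (fun _ => hf.norm_le hc _) hB

variable [DecidableEq ι] {B : Matrix ι ι ℝ}

theorem comp_mulVec_mem_roumieu (hB : B.det ≠ 0) (hs : 1 / 2 ≤ s) (hf : f ∈ roumieu ι s) :
    (fun x => f (B *ᵥ x)) ∈ roumieu ι s := by
  obtain ⟨c, ⟨r, r_pos, decay_c⟩, f_series⟩ := hf
  obtain ⟨D, κ, D_pos, κ_pos, norm_transfer_le⟩ := exists_norm_transfer_le hB
  have s_pos : 0 < s := by linarith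
  have θ_le_one : 1 / (2 * s) ≤ 1 := by
    rw [div_le_one (by positivity)]
    linarith
  obtain ⟨C, C_nonneg, norm_coeff_le⟩ := exists_norm_hermiteCoeff_comp_mulVec_le D_pos κ_pos
    norm_transfer_le s_pos r_pos decay_c f_series
  set ρ := min (κ / 2) (r / 2 * (κ / 2) ^ (1 / (2 * s)))
  have ρ_pos : 0 < ρ := lt_min (by positivity) (by positivity)
  have decay : HasDecay s ρ (hermiteCoeff fun x => f (B *ᵥ x)) := by
    refine hasDecay_of_norm_le_exp_add_exp (M := 0) C_nonneg norm_coeff_le (fun n => ?_)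
      (min_le_right _ _)
    rw [add_zero]
    gcongr
    · exact min_le_left _ _
    · exact natCast_rpow_le_self (by positivity) θ_le_one n
  exact ⟨_, ⟨ρ, ρ_pos, decay⟩, f_series.comp_mulVec (decay_c.weightedSummable s_pos r_pos)
    (decay.weightedSummable s_pos ρ_pos)⟩

theorem comp_mulVec_mem_beurling (hB : B.det ≠ 0) (hs : 1 / 2 < s) (hf : f ∈ beurling ι s) :
    (fun x => f (B *ᵥ x)) ∈ beurling ι s := by
  obtain ⟨c, decay_c, f_series⟩ := hf
  obtain ⟨D, κ, D_pos, κ_pos, norm_transfer_le⟩ := exists_norm_transfer_le hB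
  have s_pos : 0 < s := by linarith
  have θ_lt_one : 1 / (2 * s) < 1 := by
    rw [div_lt_one (by positivity)]
    linarith
  have decay (r : ℝ) (hr : 0 < r) : HasDecay s r (hermiteCoeff fun x => f (B *ᵥ x)) := by
    obtain ⟨C, C_nonneg, norm_coeff_le⟩ := exists_norm_hermiteCoeff_comp_mulVec_le D_pos κ_pos
      norm_transfer_le s_pos (r := 2 * r / (κ / 2) ^ (1 / (2 * s))) (by positivity)
      (decay_c _ (by positivity)) f_series
    obtain ⟨M, hM⟩ := exists_mul_rpow_le_mul_add (half_pos κ_pos) hr (by positivity) θ_lt_one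
    refine hasDecay_of_norm_le_exp_add_exp C_nonneg norm_coeff_le (hM · (Nat.cast_nonneg _)) ?_
    exact le_of_eq (by field_simp)
  exact ⟨_, decay, f_series.comp_mulVec ((decay_c 1 one_pos).weightedSummable s_pos one_pos)
    ((decay 1 one_pos).weightedSummable s_pos one_pos)⟩

end ChangeOfVariables

/-! ### Integral operators whose kernels are Hermite series -/

section SumIndices

variable {κ κ' : Type*} [Fintype κ] [Fintype κ']

lemma hermiteFunction_sumElim (α : κ ⊕ κ' → ℕ) (x : κ → ℝ) (y : κ' → ℝ) :
    hermiteFunction α (Sum.elim x y) =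
      hermiteFunction (α ∘ Sum.inl) x * hermiteFunction (α ∘ Sum.inr) y := by
  simp [hermiteFunction, Fintype.prod_sum_type]

lemma weight_eq_mul (α : κ ⊕ κ' → ℕ) :
    weight α = weight (α ∘ Sum.inl) * weight (α ∘ Sum.inr) := by
  simp [weight, Fintype.prod_sum_type]

lemma IsHermiteSeries.hasSum_integral_kernel {c : (κ ⊕ κ' → ℕ) → ℂ} {K : (κ ⊕ κ' → ℝ) → ℂ}
    (hK : IsHermiteSeries c K) (hc : WeightedSummable c) {φ : (κ' → ℝ) → ℂ} {M : ℝ}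
    (hφ : HermiteIntegrable φ)
    (hM : ∀ γ, ∫ y, ‖φ y * (hermiteFunction γ y : ℂ)‖ ≤ M * weight γ) (x : κ → ℝ) :
    HasSum (fun α => c α * ((hermiteFunction (α ∘ Sum.inl) x : ℂ) *
      hermiteCoeff φ (α ∘ Sum.inr))) (∫ y, K (Sum.elim x y) * φ y) := by
  simp_rw [hermiteCoeff, ← integral_const_mul (hermiteFunction _ x : ℂ)]
  refine hasSum_mul_integral (W := fun α => weight α * M) (fun α => (hφ _).const_mul _)
    (fun α => ?_) (by simpa only [mul_assoc] using Summable.mul_right M hc) fun y => ?_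
  · simp_rw [norm_mul (hermiteFunction (α ∘ Sum.inl) x : ℂ)]
    rw [integral_const_mul, weight_eq_mul, mul_assoc, mul_comm _ M]
    exact mul_le_mul (norm_hermiteFunction_le _ _) (hM _)
      (integral_nonneg fun y => norm_nonneg _) (weight_pos _).le
  · refine ((hK (Sum.elim x y)).mul_right (φ y)).congr_fun fun α => ?_
    rw [hermiteFunction_sumElim, Complex.ofReal_mul]
    ring

end SumIndices

section Twist

variable {κ κ' : Type*} [Fintype κ']

/-- The action on Hermite coefficients of the Fourier transform (`z = I`) or the inverse Fourier
transform (`z = -I`) in the second group of variables. -/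
def twist (z : ℂ) (c : (κ ⊕ κ' → ℕ) → ℂ) (α : κ ⊕ κ' → ℕ) : ℂ :=
  z ^ (∑ i, (α ∘ Sum.inr) i) * c α

lemma norm_twist {z : ℂ} (hz : ‖z‖ = 1) (c : (κ ⊕ κ' → ℕ) → ℂ) (α : κ ⊕ κ' → ℕ) :
    ‖twist z c α‖ = ‖c α‖ := by
  rw [twist, norm_mul, norm_pow, hz, one_pow, one_mul]

lemma twist_twist_of_mul_eq_one {z w : ℂ} (hzw : z * w = 1) (c : (κ ⊕ κ' → ℕ) → ℂ) :
    twist z (twist w c) = c := by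
  ext α
  rw [twist, twist, ← mul_assoc, ← mul_pow, hzw, one_pow, one_mul]

lemma IsHermiteSeries.integral_mul_cexp [Fintype κ] {c : (κ ⊕ κ' → ℕ) → ℂ} {a b : (κ ⊕ κ' → ℝ) → ℂ}
    (ha : IsHermiteSeries c a) (hb : IsHermiteSeries (twist Complex.I c) b)
    (hc : WeightedSummable c) (u : κ → ℝ) (t : κ' → ℝ) :
    ∫ ξ : κ' → ℝ, a (Sum.elim u ξ) * Complex.exp (Complex.I * ((t ⬝ᵥ ξ : ℝ) : ℂ)) =
      (√(2 * Real.pi) : ℂ) ^ Fintype.card κ' * b (Sum.elim u t) := by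
  have norm_cexp_le (ξ : κ' → ℝ) : ‖Complex.exp (Complex.I * ((t ⬝ᵥ ξ : ℝ) : ℂ))‖ ≤ 1 := by
    rw [mul_comm, Complex.norm_exp_ofReal_mul_I]
  have hermiteIntegrable_cexp : HermiteIntegrable fun ξ : κ' → ℝ =>
      Complex.exp (Complex.I * ((t ⬝ᵥ ξ : ℝ) : ℂ)) :=
    .of_bounded (Continuous.aestronglyMeasurable (by unfold dotProduct; fun_prop)) norm_cexp_le
  refine (ha.hasSum_integral_kernel hc hermiteIntegrable_cexp
    (integral_norm_mul_hermiteFunction_le_of_bounded norm_cexp_le) u).unique ?_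
  refine ((hb (Sum.elim u t)).mul_left _).congr_fun fun α => ?_
  rw [hermiteCoeff_cexp, twist, hermiteFunction_sumElim, Complex.ofReal_mul]
  simp only [Function.comp_apply]
  ring

end Twist

section SymbolKernel

variable {d : ℕ} (A : Matrix (Fin d) (Fin d) ℝ)

/-- The linear map `(x, y) ↦ (x - A (x - y), x - y)`, which turns the symbol of `Op A`,
Fourier transformed in its second variable, into the kernel. -/
def kernelMatrix : Matrix (Fin d ⊕ Fin d) (Fin d ⊕ Fin d) ℝ :=
  Matrix.fromBlocks (1 - A) A 1 (-1)

/-- The inverse `(u, t) ↦ (u + A t, u + A t - t)` of `kernelMatrix A`. -/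
def kernelMatrixInv : Matrix (Fin d ⊕ Fin d) (Fin d ⊕ Fin d) ℝ :=
  Matrix.fromBlocks 1 A 1 (A - 1)

lemma kernelMatrixInv_mul_kernelMatrix : kernelMatrixInv A * kernelMatrix A = 1 := by
  rw [kernelMatrixInv, kernelMatrix, Matrix.fromBlocks_multiply, ← Matrix.fromBlocks_one]
  congr 1 <;> simp

lemma det_kernelMatrix_ne_zero : (kernelMatrix A).det ≠ 0 :=
  Matrix.det_ne_zero_of_left_inverse (kernelMatrixInv_mul_kernelMatrix A)

lemma det_kernelMatrixInv_ne_zero : (kernelMatrixInv A).det ≠ 0 :=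
  Matrix.det_ne_zero_of_right_inverse (kernelMatrixInv_mul_kernelMatrix A)

lemma kernelMatrix_mulVec (x y : Fin d → ℝ) :
    kernelMatrix A *ᵥ Sum.elim x y = Sum.elim (x - A *ᵥ (x - y)) (x - y) := by
  rw [kernelMatrix, Matrix.fromBlocks_mulVec, Sum.elim_comp_inl, Sum.elim_comp_inr]
  congr 1
  · rw [Matrix.sub_mulVec, Matrix.one_mulVec, Matrix.mulVec_sub]
    abel
  · rw [Matrix.neg_mulVec, Matrix.one_mulVec, Matrix.one_mulVec, sub_eq_add_neg]

/-- The normalizing constant `(2π)^{-d} (2π)^{d/2}` between symbols and kernels: the first factor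
comes from `Op`, the second from the Fourier transform of Hermite functions. -/
noncomputable def kernelConst (d : ℕ) : ℂ :=
  ((2 * Real.pi : ℝ) : ℂ)⁻¹ ^ d * (√(2 * Real.pi) : ℂ) ^ d

lemma kernelConst_ne_zero (d : ℕ) : kernelConst d ≠ 0 := by
  have two_pi_ne_zero : 2 * Real.pi ≠ 0 := by positivity
  have sqrt_two_pi_ne_zero : √(2 * Real.pi) ≠ 0 := by positivity
  exact mul_ne_zero (pow_ne_zero _ (inv_ne_zero (mod_cast two_pi_ne_zero)))
    (pow_ne_zero _ (mod_cast sqrt_two_pi_ne_zero))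

lemma Op_eq_integral_kernel {c : (Fin d ⊕ Fin d → ℕ) → ℂ} {a b : (Fin d ⊕ Fin d → ℝ) → ℂ}
    (ha : IsHermiteSeries c a) (hb : IsHermiteSeries (twist Complex.I c) b)
    (hc : WeightedSummable c) (f : (Fin d → ℝ) → ℂ) (x : Fin d → ℝ) :
    Op A a f x = ∫ y, kernelConst d * b (kernelMatrix A *ᵥ Sum.elim x y) * f y := by
  simp_rw [Op, mul_right_comm _ (f _), integral_mul_const, ha.integral_mul_cexp hb hc,
    Fintype.card_fin, ← integral_const_mul, kernelMatrix_mulVec, kernelConst, mul_assoc]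

end SymbolKernel

section Composition

variable {κ κ' : Type*}

open Classical in
/-- The Hermite coefficients of the kernel `∑ γ, e γ * h_γ(x) * h_γ(y)` of an operator that is
diagonal in the Hermite basis. -/
noncomputable def diagonalCoeff (e : (κ → ℕ) → ℂ) (α : κ ⊕ κ → ℕ) : ℂ :=
  if α ∘ Sum.inl = α ∘ Sum.inr then e (α ∘ Sum.inr) else 0

lemma sumElim_self_injective :
    Function.Injective (fun γ : κ → ℕ => (Sum.elim γ γ : κ ⊕ κ → ℕ)) := fun γ γ' h => by
  simpa using congrArg (· ∘ Sum.inl) h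

lemma diagonalCoeff_sumElim_self (e : (κ → ℕ) → ℂ) (γ : κ → ℕ) :
    diagonalCoeff e (Sum.elim γ γ) = e γ := by
  simp [diagonalCoeff]

lemma diagonalCoeff_eq_zero (e : (κ → ℕ) → ℂ) {α : κ ⊕ κ → ℕ}
    (hα : α ∉ Set.range fun γ : κ → ℕ => (Sum.elim γ γ : κ ⊕ κ → ℕ)) :
    diagonalCoeff e α = 0 := by
  refine if_neg fun h => hα ⟨α ∘ Sum.inr, ?_⟩
  exact (congrArg (Sum.elim · (α ∘ Sum.inr)) h.symm).trans (Sum.elim_comp_inl_inr α)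

variable [Fintype κ] {e : (κ → ℕ) → ℂ} {f : (κ → ℝ) → ℂ} {K₂ : (κ ⊕ κ → ℝ) → ℂ}

lemma norm_hermiteCoeff_le_of_integrable (hf : Integrable f) (γ : κ → ℕ) :
    ‖hermiteCoeff f γ‖ ≤ (∫ y, ‖f y‖) * weight γ :=
  (norm_integral_le_integral_norm _).trans (integral_norm_mul_hermiteFunction_le_of_integrable hf γ)

lemma WeightedSummable.mul_hermiteCoeff (he : WeightedSummable (diagonalCoeff e))
    (hf : Integrable f) : WeightedSummable fun γ => e γ * hermiteCoeff f γ := by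
  refine ((he.comp_injective sumElim_self_injective).mul_right (∫ y, ‖f y‖)).of_nonneg_of_le
    (fun γ => mul_nonneg (norm_nonneg _) (weight_pos γ).le) fun γ => ?_
  have weight_pos := weight_pos γ
  simp only [Function.comp_apply, diagonalCoeff_sumElim_self, weight_eq_mul, Sum.elim_comp_inl,
    Sum.elim_comp_inr]
  calc ‖e γ * hermiteCoeff f γ‖ * weight γ
      ≤ ‖e γ‖ * ((∫ y, ‖f y‖) * weight γ) * weight γ := by
        rw [norm_mul]
        gcongr
        exact norm_hermiteCoeff_le_of_integrable hf γ
    _ = ‖e γ‖ * (weight γ * weight γ) * ∫ y, ‖f y‖ := by ring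

lemma IsHermiteSeries.integral_diagonal_kernel (hK₂ : IsHermiteSeries (diagonalCoeff e) K₂)
    (he : WeightedSummable (diagonalCoeff e)) (hf : Integrable f) :
    IsHermiteSeries (fun γ => e γ * hermiteCoeff f γ) (fun z => ∫ y, K₂ (Sum.elim z y) * f y) := by
  intro z
  have hasSum_kernel := hK₂.hasSum_integral_kernel he (.of_integrable hf)
    (integral_norm_mul_hermiteFunction_le_of_integrable hf) z
  rw [← sumElim_self_injective.hasSum_iff fun α hα => by
    rw [diagonalCoeff_eq_zero e hα, zero_mul]] at hasSum_kernel
  refine hasSum_kernel.congr_fun fun γ => ?_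
  simp only [Function.comp_apply, diagonalCoeff_sumElim_self, Sum.elim_comp_inl, Sum.elim_comp_inr]
  ring

theorem integral_kernel_comp_diagonal [Fintype κ'] {c : (κ' ⊕ κ → ℕ) → ℂ} {K₁ K : (κ' ⊕ κ → ℝ) → ℂ}
    (hK₁ : IsHermiteSeries c K₁) (hK₂ : IsHermiteSeries (diagonalCoeff e) K₂)
    (hK : IsHermiteSeries (fun α => c α * e (α ∘ Sum.inr)) K) (hc : WeightedSummable c)
    (he : WeightedSummable (diagonalCoeff e))
    (hce : WeightedSummable fun α => c α * e (α ∘ Sum.inr)) (hf : Integrable f) (x : κ' → ℝ) :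
    ∫ y, K (Sum.elim x y) * f y =
      ∫ z, K₁ (Sum.elim x z) * ∫ y, K₂ (Sum.elim z y) * f y := by
  have g_series := hK₂.integral_diagonal_kernel he hf
  have g_summable := he.mul_hermiteCoeff hf
  have g_bounded := g_series.norm_le g_summable
  have hasSum_left := hK.hasSum_integral_kernel hce (.of_integrable hf)
    (integral_norm_mul_hermiteFunction_le_of_integrable hf) x
  refine hasSum_left.unique ((hK₁.hasSum_integral_kernel hc
    (.of_bounded (g_series.continuous g_summable).aestronglyMeasurable g_bounded)
    (integral_norm_mul_hermiteFunction_le_of_bounded g_bounded) x).congr_fun fun α => ?_)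
  rw [g_series.hermiteCoeff_eq g_summable]
  ring

end Composition

/-! ### Factorization -/

section TailRoot

variable {ι : Type*} [Fintype ι] {s r : ℝ} {c : (ι → ℕ) → ℂ}

/-- The tail majorant `sup_{|α| ≥ m} |c_α|^{1/2}` of a coefficient family; it is a real supremum,
so it is meaningful only if `c` is bounded. -/
noncomputable def tailRoot (c : (ι → ℕ) → ℂ) (m : ℕ) : ℝ :=
  ⨆ α : {α : ι → ℕ // m ≤ ∑ i, α i}, √‖c α‖

lemma tailRoot_nonneg (c : (ι → ℕ) → ℂ) (m : ℕ) : 0 ≤ tailRoot c m :=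
  Real.iSup_nonneg fun _ => Real.sqrt_nonneg _

lemma HasDecay.exists_sqrt_le (h : HasDecay s r c) :
    ∃ C : ℝ, 0 < C ∧ ∀ α : ι → ℕ,
      √‖c α‖ ≤ C * Real.exp (-(r / 2 * (∑ i, α i : ℕ) ^ (1 / (2 * s)))) := by
  obtain ⟨C, C_pos, norm_le⟩ := h.exists_pos
  refine ⟨√C, Real.sqrt_pos.2 C_pos, fun α => ?_⟩
  rw [Real.sqrt_le_left (by positivity), mul_pow, Real.sq_sqrt C_pos.le, sq (Real.exp _),
    ← exp_neg_mul_eq_mul_self_half]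
  exact norm_le α

lemma HasDecay.sqrt_le_tailRoot (h : HasDecay s r c) (hr : 0 < r) {m : ℕ} {α : ι → ℕ}
    (hα : m ≤ ∑ i, α i) : √‖c α‖ ≤ tailRoot c m := by
  obtain ⟨C, C_pos, sqrt_le⟩ := h.exists_sqrt_le
  refine le_ciSup (f := fun α : {α : ι → ℕ // m ≤ ∑ i, α i} => √‖c α‖) ⟨C, ?_⟩ ⟨α, hα⟩
  rintro _ ⟨β, rfl⟩
  refine (sqrt_le β).trans (mul_le_of_le_one_right C_pos.le (Real.exp_le_one_iff.2 ?_))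
  exact neg_nonpos.2 (by positivity)

lemma HasDecay.exists_tailRoot_le (h : HasDecay s r c) (hs : 0 < s) (hr : 0 < r) :
    ∃ C : ℝ, 0 < C ∧ ∀ m : ℕ,
      tailRoot c m ≤ C * Real.exp (-(r / 2 * (m : ℝ) ^ (1 / (2 * s)))) := by
  obtain ⟨C, C_pos, sqrt_le⟩ := h.exists_sqrt_le
  refine ⟨C, C_pos, fun m => Real.iSup_le (fun α => (sqrt_le α).trans ?_) (by positivity)⟩
  have le_degree : (m : ℝ) ≤ (∑ i, α.1 i : ℕ) := Nat.cast_le.2 α.2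
  gcongr

end TailRoot

section Factors

variable {κ κ' : Type*} [Fintype κ] [Fintype κ'] {s r : ℝ}

lemma sum_eq_sum_inl_add_sum_inr (α : κ ⊕ κ' → ℕ) :
    ∑ i, α i = ∑ i, (α ∘ Sum.inl) i + ∑ i, (α ∘ Sum.inr) i :=
  Fintype.sum_sum_type α

/-- The eigenvalues `sup_{|α| ≥ |γ|} |c_α|^{1/2}` of the diagonal factor, composed on the right, of
the operator whose kernel has the Hermite coefficients `c`. -/
noncomputable def rightEigenvalue (c : (κ ⊕ κ' → ℕ) → ℂ) (γ : κ' → ℕ) : ℂ :=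
  tailRoot c (∑ i, γ i)

/-- The Hermite coefficients of the kernel of the left factor, whose composition with the diagonal
operator with eigenvalues `rightEigenvalue c` has the coefficients `c`. Where the eigenvalue
vanishes, so does `c`, and the junk value `0 / 0 = 0` is the right one. -/
noncomputable def leftFactor (c : (κ ⊕ κ' → ℕ) → ℂ) (α : κ ⊕ κ' → ℕ) : ℂ :=
  c α / rightEigenvalue c (α ∘ Sum.inr)

lemma norm_rightEigenvalue (c : (κ ⊕ κ' → ℕ) → ℂ) (γ : κ' → ℕ) :
    ‖rightEigenvalue c γ‖ = tailRoot c (∑ i, γ i) := by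
  rw [rightEigenvalue, Complex.norm_real, Real.norm_of_nonneg (tailRoot_nonneg _ _)]

variable {c : (κ ⊕ κ' → ℕ) → ℂ}

lemma HasDecay.sqrt_le_norm_rightEigenvalue (h : HasDecay s r c) (hr : 0 < r)
    (α : κ ⊕ κ' → ℕ) : √‖c α‖ ≤ ‖rightEigenvalue c (α ∘ Sum.inr)‖ := by
  rw [norm_rightEigenvalue]
  exact h.sqrt_le_tailRoot hr (by rw [sum_eq_sum_inl_add_sum_inr]; exact Nat.le_add_left _ _)

lemma HasDecay.norm_leftFactor_le (h : HasDecay s r c) (hr : 0 < r) (α : κ ⊕ κ' → ℕ) :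
    ‖leftFactor c α‖ ≤ √‖c α‖ := by
  rw [leftFactor, norm_div]
  refine div_le_of_le_mul₀ (norm_nonneg _) (Real.sqrt_nonneg _) ?_
  calc ‖c α‖ = √‖c α‖ * √‖c α‖ := (Real.mul_self_sqrt (norm_nonneg _)).symm
    _ ≤ √‖c α‖ * ‖rightEigenvalue c (α ∘ Sum.inr)‖ := by
        gcongr
        exact h.sqrt_le_norm_rightEigenvalue hr α

lemma HasDecay.leftFactor_mul_rightEigenvalue (h : HasDecay s r c) (hr : 0 < r) :
    (fun α => leftFactor c α * rightEigenvalue c (α ∘ Sum.inr)) = c := by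
  ext α
  refine div_mul_cancel_of_imp fun eigenvalue_eq_zero => ?_
  have sqrt_le := h.sqrt_le_norm_rightEigenvalue hr α
  rwa [eigenvalue_eq_zero, norm_zero, Real.sqrt_le_left le_rfl, zero_pow two_ne_zero,
    norm_le_zero_iff] at sqrt_le

lemma HasDecay.leftFactor (h : HasDecay s r c) (hr : 0 < r) :
    HasDecay s (1 / 2 * r) (leftFactor c) := by
  obtain ⟨C, -, sqrt_le⟩ := h.exists_sqrt_le
  refine ⟨C, fun α => (h.norm_leftFactor_le hr α).trans ?_⟩
  rw [one_div_mul_eq_div]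
  exact sqrt_le α

-- On the diagonal `|(γ, γ)| = 2 |γ|`, whence the loss of `2 ^ (-1 / (2 s))` in the rate.
lemma HasDecay.diagonalCoeff_rightEigenvalue {c : (κ ⊕ κ → ℕ) → ℂ} (h : HasDecay s r c)
    (hs : 0 < s) (hr : 0 < r) :
    HasDecay s (1 / 2 * (1 / 2) ^ (1 / (2 * s)) * r) (diagonalCoeff (rightEigenvalue c)) := by
  obtain ⟨C, C_pos, tailRoot_le⟩ := h.exists_tailRoot_le hs hr
  refine ⟨C, fun α => ?_⟩
  rw [diagonalCoeff]
  split_ifs with hα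
  · rw [norm_rightEigenvalue]
    refine (tailRoot_le _).trans_eq ?_
    rw [sum_eq_sum_inl_add_sum_inr α, hα, Nat.cast_add, ← two_mul,
      Real.mul_rpow zero_le_two (Nat.cast_nonneg _), one_div (2 : ℝ), Real.inv_rpow zero_le_two]
    congr 2
    field_simp
  · rw [norm_zero]
    positivity

end Factors

section DecayClass

/-- A class of coefficient families, cut out by a condition on the admissible rates of decay,
whose Hermite series are stable under invertible linear changes of variables. It captures what
the Roumieu and Beurling spaces have in common. -/
structure IsDecayClass {ι : Type*} [Fintype ι] [DecidableEq ι] (s : ℝ)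
    (𝒞 : Set ((ι → ℕ) → ℂ)) : Prop where
  exists_hasDecay : ∀ c ∈ 𝒞, ∃ r : ℝ, 0 < r ∧ HasDecay s r c
  of_rate : ∀ c ∈ 𝒞, ∀ (c' : (ι → ℕ) → ℂ) (ρ : ℝ), 0 < ρ →
    (∀ r : ℝ, 0 < r → HasDecay s r c → HasDecay s (ρ * r) c') → c' ∈ 𝒞
  comp_mulVec : ∀ c ∈ 𝒞, ∀ f : (ι → ℝ) → ℂ, IsHermiteSeries c f → ∀ B : Matrix ι ι ℝ,
    B.det ≠ 0 → ∃ c' ∈ 𝒞, IsHermiteSeries c' (fun x => f (B *ᵥ x))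

namespace IsDecayClass

variable {ι : Type*} [Fintype ι] [DecidableEq ι] {s : ℝ}

lemma roumieu (hs : 1 / 2 ≤ s) :
    IsDecayClass s {c : (ι → ℕ) → ℂ | ∃ r : ℝ, 0 < r ∧ HasDecay s r c} where
  exists_hasDecay _ hc := hc
  of_rate := fun _ ⟨r, hr, hc⟩ _ ρ hρ h => ⟨ρ * r, mul_pos hρ hr, h r hr hc⟩
  comp_mulVec c hc _ hf _ hB := comp_mulVec_mem_roumieu hB hs ⟨c, hc, hf⟩

lemma beurling (hs : 1 / 2 < s) :
    IsDecayClass s {c : (ι → ℕ) → ℂ | ∀ r : ℝ, 0 < r → HasDecay s r c} where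
  exists_hasDecay _ hc := ⟨1, one_pos, hc 1 one_pos⟩
  of_rate c hc c' ρ hρ h r hr := by
    simpa only [mul_div_cancel₀ r hρ.ne'] using
      h (r / ρ) (div_pos hr hρ) (hc _ (div_pos hr hρ))
  comp_mulVec c hc _ hf _ hB := comp_mulVec_mem_beurling hB hs ⟨c, hc, hf⟩

variable {𝒞 : Set ((ι → ℕ) → ℂ)} {c c' : (ι → ℕ) → ℂ}

lemma weightedSummable (h𝒞 : IsDecayClass s 𝒞) (hs : 0 < s) (hc : c ∈ 𝒞) :
    WeightedSummable c :=
  let ⟨_, hr, decay⟩ := h𝒞.exists_hasDecay c hc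
  decay.weightedSummable hs hr

lemma mem_of_norm_le (h𝒞 : IsDecayClass s 𝒞) (hc : c ∈ 𝒞) {M : ℝ} (hM : 0 ≤ M)
    (h : ∀ α, ‖c' α‖ ≤ M * ‖c α‖) : c' ∈ 𝒞 := by
  refine h𝒞.of_rate c hc c' 1 one_pos fun r _ ⟨C, hC⟩ => ⟨M * C, fun α => (h α).trans ?_⟩
  rw [one_mul, mul_assoc]
  exact mul_le_mul_of_nonneg_left (hC α) hM

lemma const_mul_mem (h𝒞 : IsDecayClass s 𝒞) (hc : c ∈ 𝒞) (w : ℂ) : (fun α => w * c α) ∈ 𝒞 :=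
  h𝒞.mem_of_norm_le hc (norm_nonneg w) fun _ => (norm_mul _ _).le

lemma twist_mem {κ κ' : Type*} [Fintype κ] [Fintype κ'] [DecidableEq κ] [DecidableEq κ']
    {𝒞 : Set ((κ ⊕ κ' → ℕ) → ℂ)} (h𝒞 : IsDecayClass s 𝒞) {c : (κ ⊕ κ' → ℕ) → ℂ} (hc : c ∈ 𝒞)
    {z : ℂ} (hz : ‖z‖ = 1) : twist z c ∈ 𝒞 :=
  h𝒞.mem_of_norm_le hc zero_le_one fun α => by rw [norm_twist hz, one_mul]

variable {d : ℕ} {𝒞 : Set ((Fin d ⊕ Fin d → ℕ) → ℂ)} {c : (Fin d ⊕ Fin d → ℕ) → ℂ}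

lemma exists_kernel (h𝒞 : IsDecayClass s 𝒞) (hs : 0 < s) (A : Matrix (Fin d) (Fin d) ℝ)
    (hc : c ∈ 𝒞) {a : (Fin d ⊕ Fin d → ℝ) → ℂ} (ha : IsHermiteSeries c a) :
    ∃ c' ∈ 𝒞, ∃ K : (Fin d ⊕ Fin d → ℝ) → ℂ, IsHermiteSeries c' K ∧
      ∀ f x, Op A a f x = ∫ y, K (Sum.elim x y) * f y := by
  have twist_mem := h𝒞.twist_mem hc Complex.norm_I
  have b_series := (h𝒞.weightedSummable hs twist_mem).isHermiteSeries_tsum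
  obtain ⟨c', hc', comp_series⟩ := h𝒞.comp_mulVec _ twist_mem _ b_series (kernelMatrix A)
    (det_kernelMatrix_ne_zero A)
  exact ⟨_, h𝒞.const_mul_mem hc' (kernelConst d), _, comp_series.const_mul (kernelConst d),
    Op_eq_integral_kernel A ha b_series (h𝒞.weightedSummable hs hc)⟩

lemma exists_symbol (h𝒞 : IsDecayClass s 𝒞) (hs : 0 < s) (A : Matrix (Fin d) (Fin d) ℝ)
    (hc : c ∈ 𝒞) {K : (Fin d ⊕ Fin d → ℝ) → ℂ} (hK : IsHermiteSeries c K) :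
    ∃ c' ∈ 𝒞, ∃ a : (Fin d ⊕ Fin d → ℝ) → ℂ, IsHermiteSeries c' a ∧
      ∀ f x, Op A a f x = ∫ y, K (Sum.elim x y) * f y := by
  obtain ⟨c₁, hc₁, comp_series⟩ := h𝒞.comp_mulVec c hc K hK (kernelMatrixInv A)
    (det_kernelMatrixInv_ne_zero A)
  have b_series := comp_series.const_mul (kernelConst d)⁻¹
  have symbol_mem := h𝒞.twist_mem (h𝒞.const_mul_mem hc₁ (kernelConst d)⁻¹)
    ((norm_neg _).trans Complex.norm_I)
  have symbol_summable := h𝒞.weightedSummable hs symbol_mem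
  rw [← twist_twist_of_mul_eq_one (by simp : Complex.I * -Complex.I = 1)
    fun α => (kernelConst d)⁻¹ * c₁ α] at b_series
  refine ⟨_, symbol_mem, _, symbol_summable.isHermiteSeries_tsum, fun f x => ?_⟩
  rw [Op_eq_integral_kernel A symbol_summable.isHermiteSeries_tsum b_series symbol_summable]
  simp_rw [Matrix.mulVec_mulVec, kernelMatrixInv_mul_kernelMatrix, Matrix.one_mulVec,
    mul_inv_cancel_left₀ (kernelConst_ne_zero d)]

theorem exists_isSharp (h𝒞 : IsDecayClass s 𝒞) (hs : 0 < s) (A : Matrix (Fin d) (Fin d) ℝ)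
    (hc : c ∈ 𝒞) {a : (Fin d ⊕ Fin d → ℝ) → ℂ} (ha : IsHermiteSeries c a) :
    ∃ a₁, (∃ c₁ ∈ 𝒞, IsHermiteSeries c₁ a₁) ∧ ∃ a₂, (∃ c₂ ∈ 𝒞, IsHermiteSeries c₂ a₂) ∧
      IsSharp A a a₁ a₂ := by
  obtain ⟨k, hk, K, K_series, Op_a⟩ := h𝒞.exists_kernel hs A hc ha
  obtain ⟨r, r_pos, decay_k⟩ := h𝒞.exists_hasDecay k hk
  have left_mem : leftFactor k ∈ 𝒞 :=
    h𝒞.of_rate k hk _ (1 / 2) (by norm_num) fun _ hr h => h.leftFactor hr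
  have right_mem : diagonalCoeff (rightEigenvalue k) ∈ 𝒞 :=
    h𝒞.of_rate k hk _ (1 / 2 * (1 / 2) ^ (1 / (2 * s))) (by positivity)
      fun _ hr h => h.diagonalCoeff_rightEigenvalue hs hr
  have left_summable := h𝒞.weightedSummable hs left_mem
  have right_summable := h𝒞.weightedSummable hs right_mem
  obtain ⟨c₁, hc₁, a₁, ha₁, Op_a₁⟩ :=
    h𝒞.exists_symbol hs A left_mem left_summable.isHermiteSeries_tsum
  obtain ⟨c₂, hc₂, a₂, ha₂, Op_a₂⟩ :=
    h𝒞.exists_symbol hs A right_mem right_summable.isHermiteSeries_tsum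
  refine ⟨a₁, ⟨c₁, hc₁, ha₁⟩, a₂, ⟨c₂, hc₂, ha₂⟩, fun f => funext fun x => ?_⟩
  have k_summable := h𝒞.weightedSummable hs hk
  rw [← decay_k.leftFactor_mul_rightEigenvalue r_pos] at K_series k_summable
  rw [Op_a, Op_a₁, funext (Op_a₂ f)]
  exact integral_kernel_comp_diagonal left_summable.isHermiteSeries_tsum
    right_summable.isHermiteSeries_tsum K_series left_summable right_summable k_summable
    f.integrable x

end IsDecayClass

end DecayClass

end Pilipovic

theorem theorem3p6 {d : ℕ} (A : Matrix (Fin d) (Fin d) ℝ) (s₁ s₂ : ℝ)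
    (hs₁ : 1 / 2 ≤ s₁) (hs₂ : 1 / 2 < s₂) :
    (∀ a ∈ Pilipovic.roumieu (Fin d ⊕ Fin d) s₁,
      ∃ a₁ ∈ Pilipovic.roumieu (Fin d ⊕ Fin d) s₁, ∃ a₂ ∈ Pilipovic.roumieu (Fin d ⊕ Fin d) s₁,
        Pilipovic.IsSharp A a a₁ a₂) ∧
    (∀ a ∈ Pilipovic.beurling (Fin d ⊕ Fin d) s₂,
      ∃ a₁ ∈ Pilipovic.beurling (Fin d ⊕ Fin d) s₂, ∃ a₂ ∈ Pilipovic.beurling (Fin d ⊕ Fin d) s₂,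
        Pilipovic.IsSharp A a a₁ a₂) := by
  refine ⟨fun a ⟨c, hc, ha⟩ => ?_, fun a ⟨c, hc, ha⟩ => ?_⟩
  · exact (Pilipovic.IsDecayClass.roumieu hs₁).exists_isSharp (by linarith) A hc ha
  · exact (Pilipovic.IsDecayClass.beurling hs₂).exists_isSharp (by linarith) A hc ha
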